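/- Let $G$ be a (Hausdorff) locally compact group, let $H$ be a closed normal subgroup of $G$, and let $\omega:G\to(0,\infty)$ be a weight, i.e. a continuous function with $\omega(xy)\le\omega(x)\omega(y)$ for all $x,y\in G$; suppose that $\omega$ is bounded away from zero. Let $\hat\omega([x])=\inf_{\xi\in H}\omega(x\xi)$ be the induced weight on $G/H$. Let $L^1(G,\omega)$ be the Banach algebra of (classes of) functions $f:G\to\mathbb C$ with $\|f\|_\omega=\int_G|f(x)|\,\omega(x)\,dx<\infty$, with convolution $(f*g)(x)=\int_G f(y)g(y^{-1}x)\,dy$ as product, and define $L^1(G/H,\hat\omega)$ likewise; all integrals are with respect to left Haar measures. Let $J_\omega(G,H)$ be the kernel of the map $T:L^1(G,\omega)\to L^1(G/H,\hat\omega)$, $(Tf)([x])=\int_H f(xh)\,dh$. Let $X$ be a Banach space complement of $J_\omega(G,H)$ in $L^1(G,\omega)$, i.e. a closed linear subspace with $L^1(G,\omega)=J_\omega(G,H)\oplus X$, such that $$x*y-y*x\in J_0\oplus X\qquad(x,y\in X),$$ where $J_0$ is the closure of the linear span of $\{f*j-j*f:\ f\in L^1(G,\omega),\ j\in J_\omega(G,H)\}$.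 If $L^1(G,\omega)$ is weakly amenable, then $L^1(G/H,\hat\omega)$ is weakly amenable. Here a Banach algebra $A$ is called weakly amenable if for every continuous linear map $D:A\to A^*$ with $D(ab)=a\cdot D(b)+D(a)\cdot b$ for $a,b\in A$ there is $\varphi\in A^*$ such that $D(a)=a\cdot\varphi-\varphi\cdot a$ for all $a\in A$, where $(a\cdot\varphi)(c)=\varphi(ca)$ and $(\varphi\cdot a)(c)=\varphi(ac)$. -/

import Mathlib

open MeasureTheory
open scoped ENNReal

/-- A (continuous) weight function on a topological group: a continuous, strictly positive,
submultiplicative real function. -/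
structure IsWeight {G : Type*} [Group G] [TopologicalSpace G] (ω : G → ℝ) : Prop where
  continuous : Continuous ω
  pos : ∀ x, 0 < ω x
  submul : ∀ x y, ω (x * y) ≤ ω x * ω y

/-- The measure `ω(x) dμ(x)`. -/
noncomputable def weightedMeasure {G : Type*} [MeasurableSpace G] (μ : Measure G) (ω : G → ℝ) :
    Measure G :=
  μ.withDensity fun x => ENNReal.ofReal (ω x)

/-- The space `L¹(G, ω)` of (classes of) complex functions `f` with `∫ |f| ω dμ < ∞`, with the norm
`‖f‖ = ∫ |f| ω dμ`. Here `μ` is a Haar measure on `G`. -/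
def BeurlingAlgebra {G : Type*} [MeasurableSpace G] (μ : Measure G) (ω : G → ℝ) : Type _ :=
  Lp ℂ 1 (weightedMeasure μ ω)

/-- Convolution on a group, `(f ∗ g)(x) = ∫ f(y) g(y⁻¹ x) dμ(y)`. -/
noncomputable def groupConv {G : Type*} [Group G] [MeasurableSpace G] (μ : Measure G)
    (f g : G → ℂ) : G → ℂ :=
  fun x => ∫ y, f y * g (y⁻¹ * x) ∂μ

namespace BeurlingAlgebra

variable {G : Type*} [MeasurableSpace G] {μ : Measure G} {ω : G → ℝ}

noncomputable instance instNormedAddCommGroup : NormedAddCommGroup (BeurlingAlgebra μ ω) :=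
  inferInstanceAs (NormedAddCommGroup (Lp ℂ 1 (weightedMeasure μ ω)))

noncomputable instance instNormedSpace : NormedSpace ℂ (BeurlingAlgebra μ ω) :=
  inferInstanceAs (NormedSpace ℂ (Lp ℂ 1 (weightedMeasure μ ω)))

/-- An element of `L¹(G, ω)`, seen in Mathlib's `L¹` space of the measure `ω dμ`. -/
def toLp (f : BeurlingAlgebra μ ω) : Lp ℂ 1 (weightedMeasure μ ω) := f

/-- A representative of an element of `L¹(G, ω)`. -/
noncomputable def toFun (f : BeurlingAlgebra μ ω) : G → ℂ := f.toLp

open Classical in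
/-- The product of `L¹(G, ω)` is convolution. For a regular Haar measure and a submultiplicative
weight the convolution of two elements always lies in `L¹(G, ω)`, and its class does not depend on
the representatives; the value `0` only makes the operation total for arbitrary `μ` and `ω`. -/
noncomputable instance instMul [Group G] : Mul (BeurlingAlgebra μ ω) where
  mul f g :=
    if h : MemLp (groupConv μ f.toFun g.toFun) 1 (weightedMeasure μ ω) then
      (h.toLp (groupConv μ f.toFun g.toFun) : Lp ℂ 1 (weightedMeasure μ ω))
    else (0 : Lp ℂ 1 (weightedMeasure μ ω))

end BeurlingAlgebra

/-- Weak amenability of a Banach algebra `A`: every continuous derivation `D : A → A*` is inner.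
The dual `A*` has the module actions `(a · φ)(c) = φ (c * a)` and `(φ · a)(c) = φ (a * c)`. -/
def WeaklyAmenable (A : Type*) [NormedAddCommGroup A] [NormedSpace ℂ A] [Mul A] : Prop :=
  ∀ D : A →L[ℂ] (A →L[ℂ] ℂ),
    (∀ a b c : A, D (a * b) c = D b (c * a) + D a (b * c)) →
      ∃ φ : A →L[ℂ] ℂ, ∀ a c : A, D a c = φ (c * a) - φ (a * c)

/-- The weight on `G ⧸ H` induced by `ω`: the infimum of `ω` over each coset. -/
noncomputable def quotientWeight {G : Type*} [Group G] (H : Subgroup G) (ω : G → ℝ) :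
    G ⧸ H → ℝ :=
  fun q => sInf (ω '' {x : G | (x : G ⧸ H) = q})

/-- The function `[x] ↦ ∫_H f(x h) dν(h)` on `G ⧸ H`; it is well defined as `ν` is left
invariant. -/
noncomputable def cosetIntegral {G : Type*} [Group G] [TopologicalSpace G] [IsTopologicalGroup G]
    [MeasurableSpace G] [BorelSpace G] (H : Subgroup G) (ν : Measure H) [ν.IsMulLeftInvariant]
    (f : G → ℂ) : G ⧸ H → ℂ :=
  Quotient.lift (fun x : G => ∫ h : H, f (x * h) ∂ν) (by
    intro x y hxy
    have hm : x⁻¹ * y ∈ H := QuotientGroup.leftRel_apply.mp hxy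
    have key := integral_mul_left_eq_self (μ := ν) (fun h : H => f (x * h)) ⟨x⁻¹ * y, hm⟩
    simpa [mul_assoc] using key.symm)

/-- The kernel `J_ω(G, H)` of the map `T : L¹(G, ω) → L¹(G ⧸ H, ω̂)`,
`(T f)([x]) = ∫_H f(x h) dν(h)`. Here `lam` is a Haar measure on `G ⧸ H`. -/
def cosetKernel {G : Type*} [Group G] [TopologicalSpace G] [IsTopologicalGroup G]
    [MeasurableSpace G] [BorelSpace G] (μ : Measure G) (ω : G → ℝ)
    (H : Subgroup G) (ν : Measure H) [ν.IsMulLeftInvariant]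
    [MeasurableSpace (G ⧸ H)] (lam : Measure (G ⧸ H)) : Set (BeurlingAlgebra μ ω) :=
  {f | ∀ᵐ q ∂lam, cosetIntegral H ν f.toFun q = 0}

/-- `X` is a Banach space complement of `J` in `A`: it is a closed subspace, and every element of
`A` is in a unique way the sum of an element of `J` and an element of `X`. (This is applied to
closed subspaces `J`.) -/
def IsBanachComplement {A : Type*} [NormedAddCommGroup A] [NormedSpace ℂ A]
    (J : Set A) (X : Submodule ℂ A) : Prop :=
  IsClosed (X : Set A) ∧ ∀ a : A, ∃! p : A × A, p.1 ∈ J ∧ p.2 ∈ X ∧ p.1 + p.2 = a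

/-- The closed linear span of the commutators `f * j - j * f`, `f ∈ A`, `j ∈ J`. -/
noncomputable def commutatorClosure {A : Type*} [NormedAddCommGroup A] [NormedSpace ℂ A] [Mul A]
    (J : Set A) : Submodule ℂ A :=
  (Submodule.span ℂ {a : A | ∃ f : A, ∃ j ∈ J, a = f * j - j * f}).topologicalClosure

/-! Write A = L¹(G, ω) and B = L¹(G/H, ω̂). The algebraic core is `WeaklyAmenable.of_surjective`.
The map T : A → B is bounded and onto, and it satisfies Tf * Tg = k T(f * g), where k > 0 is the
constant with ∫_{G/H} ∫_H = k ∫_G; it appears because the three Haar measures are not normalised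
against each other. If D is a derivation of B, then a ↦ D(Ta) ∘ T is a derivation of A, hence is
implemented by some φ in A*. It vanishes on J, so φ vanishes on J₀. As T restricts to an isomorphism
of X onto B, φ can be moved to k⁻¹ φ ∘ (T|X)⁻¹, and this functional implements D: for x, y in X the
commutator yx - xy is an element of X plus an element of J₀, and the latter is killed by both φ and
T.

The rest is analysis. G need not be σ-compact, so Fubini's theorem for Haar measures is not used for
general integrable functions, and of ω̂ only upper semicontinuity and a positive lower bound are
used. Each element of a weighted L¹ space is expanded in an absolutely convergent series of
functions in C_c (possible by `regular_weightedMeasure`); identities are proved in C_c, where Fubini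
holds by compactness of supports, and then summed. Passing to almost everywhere statements on cosets
and in convolutions needs two facts on null sets, `ae_slice_of_ae` and `ae_inv_of_ae`. The
properties of T are `exists_cosetMap`, `toFun_mul_cosetMap` and `cosetMap_surjective`. -/

open Filter Topology CompactlySupported

set_option linter.unusedSectionVars false

/-! ### Absolutely convergent series of compactly supported functions in L¹. -/

section SeriesInL1

variable {α : Type*} [MeasurableSpace α] {m : Measure α}

/-- `g` is almost everywhere the sum of the series `∑ u i`, which converges absolutely in `L¹`. -/
structure IsL1Series {ι : Type*} (m : Measure α) (u : ι → α → ℂ) (g : α → ℂ) : Prop where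
  aestronglyMeasurable : ∀ i, AEStronglyMeasurable (u i) m
  tsum_ne_top : ∑' i, ∫⁻ x, ‖u i x‖ₑ ∂m ≠ ⊤
  ae_hasSum : ∀ᵐ x ∂m, HasSum (fun i => u i x) (g x)

lemma ae_summable_norm_of_tsum_lintegral_ne_top {ι : Type*} [Countable ι] {u : ι → α → ℂ}
    (hm : ∀ i, AEStronglyMeasurable (u i) m) (hs : ∑' i, ∫⁻ x, ‖u i x‖ₑ ∂m ≠ ⊤) :
    ∀ᵐ x ∂m, Summable fun i => ‖u i x‖ := by
  rw [← lintegral_tsum fun i => (hm i).enorm] at hs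
  filter_upwards [ae_lt_top' (AEMeasurable.tsum fun i => (hm i).enorm) hs] with x hx
  have : Summable fun i => ‖u i x‖₊ := ENNReal.tsum_coe_ne_top_iff_summable.1 hx.ne
  exact NNReal.summable_coe.2 this

namespace IsL1Series

variable {ι : Type*} [Countable ι] {u : ι → α → ℂ} {g : α → ℂ}

lemma lintegral_enorm_le (h : IsL1Series m u g) :
    ∫⁻ x, ‖g x‖ₑ ∂m ≤ ∑' i, ∫⁻ x, ‖u i x‖ₑ ∂m := by
  rw [← lintegral_tsum fun i => (h.aestronglyMeasurable i).enorm]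
  refine lintegral_mono_ae ?_
  filter_upwards [h.ae_hasSum] with x hx
  rw [← hx.tsum_eq]
  exact enorm_tsum_le_tsum_enorm

lemma memLp (h : IsL1Series m u g) : MemLp g 1 m := by
  refine ⟨?_, ?_⟩
  · have h2 : ∀ᵐ x ∂m, Tendsto (fun s : Finset ι => ∑ i ∈ s, u i x) atTop (𝓝 (g x)) := h.ae_hasSum
    exact aestronglyMeasurable_of_tendsto_ae atTop
      (fun s => Finset.aestronglyMeasurable_fun_sum s fun i _ => h.aestronglyMeasurable i) h2
  · rw [eLpNorm_one_eq_lintegral_enorm]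
    exact h.lintegral_enorm_le.trans_lt h.tsum_ne_top.lt_top

end IsL1Series

/-- By density it suffices to treat the indicator of a set t of finite measure. Regularity gives a
compact s ⊆ t and an open U ⊇ s with t \ s and U \ s small, and a Urysohn function for s and U
differs from the indicator only there, by at most 1 on each piece. -/
lemma MeasureTheory.MemLp.exists_compactlySupported_eLpNorm_one_sub_le [TopologicalSpace α]
    [BorelSpace α] [T2Space α] [LocallyCompactSpace α] [m.Regular] {f : α → ℂ} (hf : MemLp f 1 m)
    {ε : ℝ≥0∞} (hε : ε ≠ 0) : ∃ g : C_c(α, ℂ), eLpNorm (f - (g : α → ℂ)) 1 m ≤ ε := by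
  suffices H : ∃ g : α → ℂ, eLpNorm (f - g) 1 m ≤ ε ∧ Continuous g ∧ HasCompactSupport g by
    obtain ⟨g, hg, hc, hs⟩ := H
    exact ⟨⟨⟨g, hc⟩, hs⟩, hg⟩
  refine hf.induction_dense ENNReal.one_ne_top _ ?_ ?_ ?_ hε
  · intro c t ht htm ε hε
    obtain ⟨η, hη0, hη⟩ : ∃ η : ℝ≥0∞, η ≠ 0 ∧ ‖c‖ₑ * (η + η) ≤ ε := by
      -- The summand 1 keeps the denominator nonzero when c = 0.
      refine ⟨ε / 2 / (‖c‖ₑ + 1), ?_, ?_⟩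
      · exact (ENNReal.div_pos (ENNReal.half_pos hε).ne' (by finiteness)).ne'
      · rw [ENNReal.div_add_div_same, ENNReal.add_halves, ENNReal.div_eq_inv_mul, ← mul_assoc,
          ← div_eq_mul_inv]
        refine mul_le_of_le_one_left' ?_
        exact ENNReal.div_le_of_le_mul (by simp)
    obtain ⟨s, hst, hs, -, hms⟩ := ht.exists_isCompact_isClosed_sdiff_lt htm.ne hη0
    obtain ⟨U, hsU, hU, hmU⟩ := hs.exists_isOpen_lt_add (μ := m) hη0
    obtain ⟨φ, hφ1, hφ0, hφc, hφ⟩ := exists_continuous_one_zero_of_isCompact hs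
      hU.isClosed_compl (Set.disjoint_compl_right_iff_subset.2 hsU)
    refine ⟨fun x => (φ x : ℂ) * c, ?_, by fun_prop, ?_⟩
    · rw [eLpNorm_one_eq_lintegral_enorm]
      have hms' : m (U \ s) ≤ η := by
        rw [measure_sdiff hsU hs.measurableSet.nullMeasurableSet hs.measure_ne_top]
        exact tsub_le_iff_left.2 hmU.le
      calc _ ≤ ∫⁻ x, ‖c‖ₑ * ((U \ s).indicator 1 x + (t \ s).indicator 1 x) ∂m := by
            refine lintegral_mono fun x => ?_
            by_cases hxs : x ∈ s
            · simp [hxs, hφ1 hxs, hst hxs]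
            have hφle : ‖(φ x : ℂ)‖ₑ ≤ 1 := by
              rw [← ofReal_norm, Complex.norm_real, Real.norm_of_nonneg (hφ x).1]
              simpa using (hφ x).2
            have hφ1le : ‖(φ x : ℂ) - 1‖ₑ ≤ 1 := by
              rw [show (φ x : ℂ) - 1 = ((φ x - 1 : ℝ) : ℂ) by push_cast; rfl, ← ofReal_norm,
                Complex.norm_real, Real.norm_of_nonpos (by linarith [(hφ x).2])]
              simpa using (hφ x).1
            by_cases hxU : x ∈ U
            · by_cases hxt : x ∈ t
              · simp only [Pi.sub_apply, Set.indicator_of_mem hxt]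
                rw [show (φ x : ℂ) * c - c = c * (φ x - 1) by ring, enorm_mul]
                simp only [Set.mem_sdiff, hxU, hxs, not_false_eq_true, and_self,
                  Set.indicator_of_mem, Pi.one_apply, hxt]
                gcongr
                exact hφ1le.trans (by simp)
              · simp only [Pi.sub_apply, Set.indicator_of_notMem hxt, sub_zero, enorm_mul]
                simp only [Set.mem_sdiff, hxU, hxs, not_false_eq_true, and_self,
                  Set.indicator_of_mem, Pi.one_apply, hxt, false_and, Set.indicator_of_notMem,
                  add_zero, mul_one]
                exact mul_le_of_le_one_left' hφle
            · have : φ x = 0 := hφ0 hxU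
              by_cases hxt : x ∈ t <;> simp [this, hxt, hxs, hxU]
        _ = ‖c‖ₑ * (m (U \ s) + m (t \ s)) := by
            have h1 : MeasurableSet (U \ s) := hU.measurableSet.diff hs.measurableSet
            have h2 : MeasurableSet (t \ s) := ht.diff hs.measurableSet
            rw [lintegral_const_mul' _ _ enorm_ne_top, lintegral_add_left
              (measurable_one.indicator h1), lintegral_indicator_one h1, lintegral_indicator_one h2]
        _ ≤ ‖c‖ₑ * (η + η) := by gcongr
        _ ≤ ε := hη
    · exact HasCompactSupport.mul_right (hφc.comp_left (g := fun r : ℝ => (r : ℂ)) (by simp))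
  · rintro f g ⟨hf, hf'⟩ ⟨hg, hg'⟩
    exact ⟨hf.add hg, hf'.add hg'⟩
  · rintro f ⟨hf, hf'⟩
    exact (hf.stronglyMeasurable_of_hasCompactSupport hf').aestronglyMeasurable

/-- Telescope a sequence of approximations A n with errors δ n of total less than ε. The first term
exceeds the norm of f by at most ε, and the differences cost δ n + δ (n + 1), that is, at most 2ε
together. -/
lemma MeasureTheory.MemLp.exists_isL1Series_compactlySupported [TopologicalSpace α] [BorelSpace α]
    [T2Space α] [LocallyCompactSpace α] [m.Regular] {f : α → ℂ} (hf : MemLp f 1 m)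
    {ε : ℝ≥0∞}
    (hε : ε ≠ 0) (htop : ε ≠ ⊤) :
    ∃ u : ℕ → C_c(α, ℂ), IsL1Series m (fun n => u n) f ∧
      ∑' n, ∫⁻ x, ‖u n x‖ₑ ∂m ≤ ∫⁻ x, ‖f x‖ₑ ∂m + 3 * ε := by
  obtain ⟨δ, hδ0, hδ⟩ := ENNReal.exists_pos_sum_of_countable' hε ℕ
  choose A ha using fun n => hf.exists_compactlySupported_eLpNorm_one_sub_le (hδ0 n).ne'
  have hA : ∀ n, ∫⁻ x, ‖f x - A n x‖ₑ ∂m ≤ δ n := fun n => by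
    have := ha n
    rwa [eLpNorm_one_eq_lintegral_enorm] at this
  have hAm : ∀ n, AEStronglyMeasurable (A n) m := fun n => (A n).continuous.stronglyMeasurable_of_hasCompactSupport (A n).hasCompactSupport |>.aestronglyMeasurable
  let u : ℕ → C_c(α, ℂ) := fun n => Nat.casesOn n (A 0) fun k => A (k + 1) - A k
  have hu0 : u 0 = A 0 := rfl
  have hus : ∀ k, u (k + 1) = A (k + 1) - A k := fun k => rfl
  have hpart : ∀ n x, ∑ k ∈ Finset.range (n + 1), u k x = A n x := by
    intro n x
    induction n with
    | zero => simp [hu0]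
    | succ n ih => rw [Finset.sum_range_succ, ih, hus]; simp
  have hum : ∀ n, AEStronglyMeasurable (u n) m := by
    rintro (_ | n)
    · exact hAm 0
    · exact (hAm (n + 1)).sub (hAm n)
  have hbound : ∑' n, ∫⁻ x, ‖u n x‖ₑ ∂m ≤ ∫⁻ x, ‖f x‖ₑ ∂m + 3 * ε := by
    have h0 : ∫⁻ x, ‖u 0 x‖ₑ ∂m ≤ ∫⁻ x, ‖f x‖ₑ ∂m + ε := by
      calc ∫⁻ x, ‖u 0 x‖ₑ ∂m ≤ ∫⁻ x, (‖f x‖ₑ + ‖f x - A 0 x‖ₑ) ∂m := by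
            refine lintegral_mono fun x => ?_
            have : u 0 x = f x - (f x - A 0 x) := by simp [hu0]
            rw [this]
            exact enorm_sub_le
        _ = ∫⁻ x, ‖f x‖ₑ ∂m + ∫⁻ x, ‖f x - A 0 x‖ₑ ∂m :=
            lintegral_add_left' hf.aestronglyMeasurable.enorm _
        _ ≤ _ := by
            gcongr
            exact (hA 0).trans ((ENNReal.le_tsum 0).trans hδ.le)
    have hs : ∀ n, ∫⁻ x, ‖u (n + 1) x‖ₑ ∂m ≤ δ n + δ (n + 1) := fun n => by
      calc ∫⁻ x, ‖u (n + 1) x‖ₑ ∂m ≤ ∫⁻ x, (‖f x - A n x‖ₑ + ‖f x - A (n + 1) x‖ₑ) ∂m := by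
            refine lintegral_mono fun x => ?_
            have : u (n + 1) x = (f x - A n x) - (f x - A (n + 1) x) := by simp [hus]
            rw [this]
            exact enorm_sub_le
        _ = ∫⁻ x, ‖f x - A n x‖ₑ ∂m + ∫⁻ x, ‖f x - A (n + 1) x‖ₑ ∂m :=
            lintegral_add_left' (hf.aestronglyMeasurable.sub (hAm n)).enorm _
        _ ≤ _ := add_le_add (hA n) (hA (n + 1))
    rw [tsum_eq_zero_add' ENNReal.summable]
    calc _ ≤ (∫⁻ x, ‖f x‖ₑ ∂m + ε) + ∑' n, (δ n + δ (n + 1)) :=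
          add_le_add h0 (ENNReal.tsum_le_tsum hs)
      _ ≤ (∫⁻ x, ‖f x‖ₑ ∂m + ε) + (ε + ε) := by
          rw [ENNReal.tsum_add]
          gcongr
          refine le_trans ?_ hδ.le
          conv_rhs => rw [tsum_eq_zero_add' ENNReal.summable]
          exact le_add_self
      _ = _ := by ring
  have hne : ∑' n, ∫⁻ x, ‖u n x‖ₑ ∂m ≠ ⊤ := by
    refine (hbound.trans_lt ?_).ne
    have := hf.eLpNorm_lt_top
    rw [eLpNorm_one_eq_lintegral_enorm] at this
    exact ENNReal.add_lt_top.2 ⟨this, ENNReal.mul_lt_top (by simp) (lt_top_iff_ne_top.2 htop)⟩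
  refine ⟨u, ⟨hum, hne, ?_⟩, hbound⟩
  -- The errors are summable in L¹, so f - A n tends to 0 almost everywhere; this identifies the
  -- pointwise sum with f without passing to a subsequence.
  have hconv : ∑' n, ∫⁻ x, ‖f x - A n x‖ₑ ∂m ≠ ⊤ :=
    ((ENNReal.tsum_le_tsum hA).trans_lt (hδ.trans_le le_top)).ne
  filter_upwards [ae_summable_norm_of_tsum_lintegral_ne_top hum hne,
    ae_summable_norm_of_tsum_lintegral_ne_top (u := fun n x => f x - A n x)
      (fun n => hf.aestronglyMeasurable.sub (hAm n)) hconv] with x hx1 hx2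
  refine (Summable.hasSum_iff_tendsto_nat hx1.of_norm).2 ?_
  rw [← tendsto_add_atTop_iff_nat 1]
  simp only [hpart]
  have h3 := hx2.tendsto_atTop_zero
  have h4 : Tendsto (fun n => f x - A n x) atTop (𝓝 0) := tendsto_zero_iff_norm_tendsto_zero.2 h3
  simpa using h4.const_sub (f x)

end SeriesInL1

/-! ### Regularity of weighted measures. -/

section WeightedMeasure

variable {α : Type*} [MeasurableSpace α] {m : Measure α} {w : α → ℝ}

lemma lintegral_weightedMeasure (hw : Measurable w) (f : α → ℝ≥0∞) :
    ∫⁻ x, f x ∂weightedMeasure m w = ∫⁻ x, ENNReal.ofReal (w x) * f x ∂m :=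
  lintegral_withDensity_eq_lintegral_mul_non_measurable _ hw.ennreal_ofReal (by simp) f

lemma ae_weightedMeasure_iff (hw : Measurable w) (hpos : ∀ x, 0 < w x) {p : α → Prop} :
    (∀ᵐ x ∂weightedMeasure m w, p x) ↔ ∀ᵐ x ∂m, p x := by
  rw [weightedMeasure, ae_withDensity_iff hw.ennreal_ofReal]
  simp [hpos]

lemma weightedMeasure_absolutelyContinuous : weightedMeasure m w ≪ m :=
  withDensity_absolutelyContinuous _ _

lemma mul_measure_le_weightedMeasure {δ : ℝ} (hδ : ∀ x, δ ≤ w x) (s : Set α) :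
    ENNReal.ofReal δ * m s ≤ weightedMeasure m w s := by
  refine le_trans ?_ (withDensity_apply_le _ s)
  rw [← setLIntegral_const]
  exact lintegral_mono fun x => ENNReal.ofReal_le_ofReal (hδ x)

lemma weightedMeasure_le_mul_of_subset (hw : Measurable w) {c : ℝ} {s : Set α}
    (hs : ∀ x ∈ s, w x ≤ c) : weightedMeasure m w s ≤ ENNReal.ofReal c * m s := by
  have key : ∀ t, MeasurableSet t → (∀ x ∈ t, w x ≤ c) →
      weightedMeasure m w t ≤ ENNReal.ofReal c * m t := by
    intro t ht htc
    rw [weightedMeasure, withDensity_apply _ ht, ← setLIntegral_const]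
    exact setLIntegral_mono' ht fun x hx => ENNReal.ofReal_le_ofReal (htc x hx)
  have hT : MeasurableSet {x | w x ≤ c} := measurableSet_le hw measurable_const
  calc weightedMeasure m w s ≤ weightedMeasure m w (toMeasurable m s ∩ {x | w x ≤ c}) :=
        measure_mono fun x hx => ⟨subset_toMeasurable m s hx, hs x hx⟩
    _ ≤ ENNReal.ofReal c * m (toMeasurable m s ∩ {x | w x ≤ c}) :=
        key _ ((measurableSet_toMeasurable m s).inter hT) fun x hx => hx.2
    _ ≤ ENNReal.ofReal c * m s := by
        grw [Set.inter_subset_left, measure_toMeasurable s]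

variable [TopologicalSpace α] [BorelSpace α]

lemma isFiniteMeasureOnCompacts_weightedMeasure [IsFiniteMeasureOnCompacts m]
    (husc : UpperSemicontinuous w) : IsFiniteMeasureOnCompacts (weightedMeasure m w) := by
  refine ⟨fun {K} hK => ?_⟩
  obtain ⟨n, hn⟩ := hK.elim_directed_cover (fun n : ℕ => {x | w x < n})
    (fun n => husc.isOpen_preimage n) (fun x _ => Set.mem_iUnion.2 (exists_nat_gt (w x)))
    (directed_of_isDirected_le fun i j hij x (hx : w x < i) =>
      hx.trans_le (Nat.cast_le.2 hij))
  refine (weightedMeasure_le_mul_of_subset husc.measurable fun x hx => (hn hx).le).trans_lt ?_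
  exact ENNReal.mul_lt_top (by simp) hK.measure_lt_top

/-- Upper semicontinuity makes the sets {w < n} open with density at most n on them, so outer
approximations for m can be cut down to them and glued. The lower bound δ makes sets of finite
weighted measure m-finite. Continuity of w is not assumed, since the result is applied to the
induced weight. -/
lemma regular_weightedMeasure [T2Space α] [m.Regular] (husc : UpperSemicontinuous w) {δ : ℝ} (hδ0 : 0 < δ)
    (hδ : ∀ x, δ ≤ w x) : (weightedMeasure m w).Regular := by
  have hfin := isFiniteMeasureOnCompacts_weightedMeasure (m := m) husc
  have hw := husc.measurable
  refine { hfin with outerRegular := ?_, innerRegular := ?_ }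
  · intro A hA r hr
    have hAm : m A ≠ ⊤ := by
      have h1 := (mul_measure_le_weightedMeasure (m := m) hδ A).trans_lt (hr.trans_le le_top)
      exact (ENNReal.lt_top_of_mul_ne_top_right h1.ne (by simp [hδ0])).ne
    obtain ⟨ε, hε0, hε⟩ := ENNReal.lt_iff_exists_add_pos_lt.1 hr
    obtain ⟨η, hη0, hη⟩ := ENNReal.exists_pos_sum_of_countable' (ENNReal.coe_ne_zero.2 hε0.ne') ℕ
    have hex : ∀ n : ℕ, ∃ U, A ∩ {x | w x < n} ⊆ U ∧ IsOpen U ∧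
        weightedMeasure m w (U \ (A ∩ {x | w x < n})) ≤ η n := by
      intro n
      have hAn : MeasurableSet (A ∩ {x | w x < n}) :=
        hA.inter (measurableSet_lt hw measurable_const)
      obtain ⟨U, hAU, hU, -, hmU⟩ := hAn.exists_isOpen_sdiff_lt (μ := m)
        ((measure_mono Set.inter_subset_left).trans_lt hAm.lt_top).ne
        -- The density is at most n on {w < n}, so this error weighs at most η n; n + 1 avoids
        -- dividing by 0.
        (ε := η n / (n + 1)) (ENNReal.div_pos (hη0 n).ne' (by finiteness)).ne'
      refine ⟨U ∩ {x | w x < n}, Set.subset_inter hAU Set.inter_subset_right,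
        hU.inter (husc.isOpen_preimage n), ?_⟩
      refine (weightedMeasure_le_mul_of_subset hw (c := n) fun x hx => hx.1.2.le).trans ?_
      calc ENNReal.ofReal n * m ((U ∩ {x | w x < n}) \ (A ∩ {x | w x < n}))
          ≤ (n + 1) * (η n / (n + 1)) := by
            gcongr
            · simp
            · exact (measure_mono (Set.sdiff_subset_sdiff_left Set.inter_subset_left)).trans hmU.le
        _ ≤ η n := ENNReal.mul_div_le
    choose U hAU hU hmU using hex
    refine ⟨⋃ n, U n, fun x hx => ?_, isOpen_iUnion hU, ?_⟩
    · obtain ⟨n, hn⟩ := exists_nat_gt (w x)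
      exact Set.mem_iUnion.2 ⟨n, hAU n ⟨hx, hn⟩⟩
    · refine lt_of_le_of_lt ?_ hε
      calc weightedMeasure m w (⋃ n, U n)
          ≤ weightedMeasure m w (A ∪ ⋃ n, U n \ (A ∩ {x | w x < n})) := by
            refine measure_mono fun x hx => ?_
            obtain ⟨n, hn⟩ := Set.mem_iUnion.1 hx
            by_cases hxA : x ∈ A
            · exact Or.inl hxA
            · exact Or.inr (Set.mem_iUnion.2 ⟨n, hn, fun h => hxA h.1⟩)
        _ ≤ weightedMeasure m w A + ∑' n, weightedMeasure m w (U n \ (A ∩ {x | w x < n})) :=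
            (measure_union_le _ _).trans (by gcongr; exact measure_iUnion_le _)
        _ ≤ weightedMeasure m w A + ε := by
            gcongr
            exact (ENNReal.tsum_le_tsum hmU).trans hη.le
  · intro U hU r hr
    -- If m U is infinite, the lower bound δ transfers large compact sets from m. If it is finite,
    -- compact sets exhaust U up to an m-null set, which is also null for the weighted measure.
    by_cases hmU : m U = ⊤
    · have : r ≠ ⊤ := (hr.trans_le le_top).ne
      obtain ⟨K, hKU, hK, hrK⟩ := hU.exists_lt_isCompact (μ := m) (r := r / ENNReal.ofReal δ)
        (by rw [hmU]; exact ENNReal.div_lt_top this (by simp [hδ0]))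
      refine ⟨K, hKU, hK, lt_of_lt_of_le ?_ (mul_measure_le_weightedMeasure hδ K)⟩
      rwa [mul_comm, ← ENNReal.div_lt_iff (by simp [hδ0]) (by simp)]
    · have hex : ∀ n : ℕ, ∃ K ⊆ U, IsCompact K ∧ IsClosed K ∧ m (U \ K) < (n + 1 : ℝ≥0∞)⁻¹ :=
        fun n => hU.measurableSet.exists_isCompact_isClosed_sdiff_lt hmU
          (ENNReal.inv_ne_zero.2 (by finiteness))
      choose K hKU hK hKc hKm using hex
      have hnull : m (U \ ⋃ n, K n) = 0 := by
        refine le_antisymm (ge_of_tendsto' (f := fun n : ℕ => (n + 1 : ℝ≥0∞)⁻¹)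
          (x := atTop) ?_ fun n => ?_) zero_le
        · have := ENNReal.tendsto_inv_nat_nhds_zero.comp (tendsto_add_atTop_nat 1)
          simpa [Function.comp_def] using this
        · exact (measure_mono (Set.sdiff_subset_sdiff_right (Set.subset_iUnion K n))).trans
            (hKm n).le
      have hle : weightedMeasure m w U ≤ weightedMeasure m w (⋃ n, Set.accumulate K n) := by
        rw [Set.iUnion_accumulate]
        refine (measure_le_inter_add_sdiff _ U (⋃ n, K n)).trans ?_
        rw [weightedMeasure_absolutelyContinuous hnull, add_zero]
        exact measure_mono Set.inter_subset_right
      rw [Set.monotone_accumulate.measure_iUnion] at hle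
      obtain ⟨n, hn⟩ := lt_iSup_iff.1 (hr.trans_le hle)
      exact ⟨_, Set.iUnion₂_subset fun n _ => hKU n, isCompact_accumulate hK n, hn⟩

end WeightedMeasure

/-! ### Weil's integration formula and slices of null sets. -/

section Weil

variable {G : Type*} [Group G] [TopologicalSpace G] [IsTopologicalGroup G]
  [LocallyCompactSpace G] [T2Space G] [MeasurableSpace G] [BorelSpace G]
  {H : Subgroup G} [H.Normal] {hH : IsClosed (H : Set G)}
  [MeasurableSpace (G ⧸ H)] [BorelSpace (G ⧸ H)]
  {μ : Measure G} [μ.IsHaarMeasure] [μ.Regular]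
  {ν : Measure H} [ν.IsHaarMeasure]
  {lam : Measure (G ⧸ H)} [lam.IsHaarMeasure] [lam.Regular]

/-- Integration over the cosets of a closed normal subgroup, as a linear map between spaces of
compactly supported continuous functions. -/
noncomputable abbrev cosetPushforward {E : Type*} [NormedAddCommGroup E] [NormedSpace ℝ E]
    (hH : IsClosed (H : Set G)) (ν : Measure H) [ν.IsHaarMeasure] :
    C_c(G, E) →ₗ[ℝ] C_c(G ⧸ H, E) :=
  (TopologicalGroup.IsSES.ofClosedSubgroup H hH).pushforward ν

lemma continuous_isCompact_slice {E : Type*} [NormedAddCommGroup E] (hH : IsClosed (H : Set G))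
    (f : C_c(G, E)) (x : G) :
    Continuous (fun h : H => f (x * h)) ∧ HasCompactSupport (fun h : H => f (x * h)) := by
  let p := (TopologicalGroup.IsSES.ofClosedSubgroup H hH).pullback f x
  exact ⟨p.continuous, p.hasCompactSupport⟩

lemma integrable_slice {E : Type*} [NormedAddCommGroup E] (hH : IsClosed (H : Set G))
    (f : C_c(G, E)) (x : G) : Integrable (fun h : H => f (x * h)) ν :=
  (continuous_isCompact_slice hH f x).1.integrable_of_hasCompactSupport
    (continuous_isCompact_slice hH f x).2

lemma cosetPushforward_mk {E : Type*} [NormedAddCommGroup E] [NormedSpace ℝ E]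
    (hH : IsClosed (H : Set G)) (f : C_c(G, E)) (x : G) :
    cosetPushforward hH ν f (x : G ⧸ H) = ∫ h : H, f (x * h) ∂ν :=
  (TopologicalGroup.IsSES.ofClosedSubgroup H hH).pushforward_apply_apply ν f x

lemma cosetIntegral_mk (f : G → ℂ) (x : G) :
    cosetIntegral H ν f (x : G ⧸ H) = ∫ h : H, f (x * h) ∂ν := rfl

/-- Integrating over H and then over G/H defines a Haar measure on G, so uniqueness of Haar measure
makes it a multiple of μ. -/
lemma exists_integral_cosetPushforward_eq_real (hH : IsClosed (H : Set G)) (μ : Measure G)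
    [μ.IsHaarMeasure] [μ.Regular] (ν : Measure H) [ν.IsHaarMeasure]
    (lam : Measure (G ⧸ H)) [lam.IsHaarMeasure] :
    ∃ k : ℝ, 0 < k ∧ ∀ f : C_c(G, ℝ),
      ∫ q, cosetPushforward hH ν f q ∂lam = k * ∫ x, f x ∂μ := by
  let S := TopologicalGroup.IsSES.ofClosedSubgroup H hH
  let ρ := S.inducedMeasure ν lam
  have hρ : ρ = Measure.haarScalarFactor ρ μ • μ :=
    Measure.isMulLeftInvariant_eq_smul_of_regular ρ μ
  refine ⟨Measure.haarScalarFactor ρ μ, ?_, fun f => ?_⟩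
  · exact_mod_cast Measure.haarScalarFactor_pos_of_isHaarMeasure ρ μ
  · have h1 : ∫ x, f x ∂ρ = ∫ q, cosetPushforward hH ν f q ∂lam :=
      S.integral_inducedMeasure ν lam f
    have h2 : ∫ x, f x ∂ρ = ∫ x, f x ∂(Measure.haarScalarFactor ρ μ • μ) :=
      congrArg (fun m : Measure G => ∫ x, f x ∂m) hρ
    rw [← h1, h2, integral_smul_nnreal_measure, NNReal.smul_def, smul_eq_mul]

/-- The composition of a compactly supported continuous function with a continuous linear map. -/
noncomputable def CompactlySupportedContinuousMap.compCLM {X E F : Type*} [TopologicalSpace X]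
    [NormedAddCommGroup E] [NormedSpace ℝ E] [NormedAddCommGroup F] [NormedSpace ℝ F]
    (L : E →L[ℝ] F) (f : C_c(X, E)) : C_c(X, F) :=
  ⟨⟨fun x => L (f x), by fun_prop⟩, f.hasCompactSupport.comp_left (map_zero L)⟩

lemma cosetPushforward_compCLM {E F : Type*} [NormedAddCommGroup E] [NormedSpace ℝ E]
    [CompleteSpace E] [NormedAddCommGroup F] [NormedSpace ℝ F] [CompleteSpace F]
    (hH : IsClosed (H : Set G)) (L : E →L[ℝ] F) (f : C_c(G, E)) (q : G ⧸ H) :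
    cosetPushforward hH ν (f.compCLM L) q = L (cosetPushforward hH ν f q) := by
  induction q using QuotientGroup.induction_on with
  | H x =>
    rw [cosetPushforward_mk, cosetPushforward_mk, ← L.integral_comp_comm (integrable_slice hH f x)]
    rfl

/-- One k serves both scalar fields: the complex formula follows by composing with the real and
imaginary parts, which commute with all the integrals. -/
lemma exists_integral_cosetPushforward_eq (hH : IsClosed (H : Set G)) (μ : Measure G)
    [μ.IsHaarMeasure] [μ.Regular] (ν : Measure H) [ν.IsHaarMeasure]
    (lam : Measure (G ⧸ H)) [lam.IsHaarMeasure] :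
    ∃ k : ℝ, 0 < k ∧ (∀ f : C_c(G, ℝ),
      ∫ q, cosetPushforward hH ν f q ∂lam = k * ∫ x, f x ∂μ) ∧
      ∀ f : C_c(G, ℂ), ∫ q, cosetPushforward hH ν f q ∂lam = k * ∫ x, f x ∂μ := by
  obtain ⟨k, hk, h⟩ := exists_integral_cosetPushforward_eq_real hH μ ν lam
  refine ⟨k, hk, h, fun f => ?_⟩
  have key : ∀ L : ℂ →L[ℝ] ℝ,
      L (∫ q, cosetPushforward hH ν f q ∂lam) = L (k * ∫ x, f x ∂μ) := by
    intro L
    have h1 := h (f.compCLM L)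
    have hf : Integrable f μ := f.continuous.integrable_of_hasCompactSupport f.hasCompactSupport
    have hTf : Integrable (cosetPushforward hH ν f) lam :=
      (cosetPushforward hH ν f).continuous.integrable_of_hasCompactSupport
        (cosetPushforward hH ν f).hasCompactSupport
    rw [← L.integral_comp_comm hTf, ← Complex.real_smul, map_smul, ← L.integral_comp_comm hf]
    rw [integral_congr_ae (Eventually.of_forall fun q => cosetPushforward_compCLM hH L f q)] at h1
    exact h1
  exact Complex.ext (key Complex.reCLM) (key Complex.imCLM)

/-- A Chebyshev type inequality for the slices of an open set along the cosets. -/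
lemma exists_isOpen_mul_measure_le [ν.Regular] (hH : IsClosed (H : Set G)) {k : ℝ} (hk0 : 0 < k)
    (hk : ∀ f : C_c(G, ℝ), ∫ q, cosetPushforward hH ν f q ∂lam = k * ∫ x, f x ∂μ)
    {U : Set G} (hU : IsOpen U) {t : ℝ} (ht : 0 < t) :
    ∃ E : Set (G ⧸ H), (∀ x : G, ENNReal.ofReal t < ν {h : H | x * h ∈ U} → (x : G ⧸ H) ∈ E) ∧
      ENNReal.ofReal t * lam E ≤ ENNReal.ofReal k * μ U := by
  -- A slice of U of measure above t is detected by a single f in F. The sets V f are open and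
  -- directed, so a compact part of their union lies in one V f, where Markov's inequality and
  -- Weil's formula for that f apply.
  let F := {f : C_c(G, ℝ) // (∀ x, 0 ≤ f x) ∧ (∀ x, f x ≤ 1) ∧ ∀ x ∉ U, f x = 0}
  let V : F → Set (G ⧸ H) := fun f => {q | t < cosetPushforward hH ν f.1 q}
  have hV : ∀ f, IsOpen (V f) := fun f =>
    isOpen_lt continuous_const (cosetPushforward hH ν f.1).continuous
  have hmono : ∀ f g : C_c(G, ℝ), f ≤ g → cosetPushforward hH ν f ≤ cosetPushforward hH ν g :=
    fun f g hfg => (TopologicalGroup.IsSES.ofClosedSubgroup H hH).pushforward_mono ν hfg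
  have hdir : Directed (· ⊆ ·) V := by
    intro f g
    refine ⟨⟨f.1 ⊔ g.1, fun x => le_sup_of_le_left (f.2.1 x),
      fun x => sup_le (f.2.2.1 x) (g.2.2.1 x), fun x hx => ?_⟩, ?_, ?_⟩
    · simp [f.2.2.2 x hx, g.2.2.2 x hx]
    · exact fun q (hq : t < _) => hq.trans_le (hmono _ _ le_sup_left q)
    · exact fun q (hq : t < _) => hq.trans_le (hmono _ _ le_sup_right q)
  refine ⟨⋃ f, V f, fun x hx => ?_, ?_⟩
  · have hUx : IsOpen {h : H | x * h ∈ U} := hU.preimage (by fun_prop)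
    obtain ⟨C, hCU, hC, htC⟩ := hUx.exists_lt_isCompact hx
    have hC' : IsCompact ((fun h : H => x * (h : G)) '' C) := hC.image (by fun_prop)
    obtain ⟨φ, hφ1, hφ0, hφc, hφ⟩ := exists_continuous_one_zero_of_isCompact hC'
      hU.isClosed_compl (Set.disjoint_compl_right_iff_subset.2 (Set.image_subset_iff.2 hCU))
    let f : F := ⟨⟨φ, hφc⟩, fun y => (hφ y).1, fun y => (hφ y).2, fun y hy => hφ0 hy⟩
    refine Set.mem_iUnion.2 ⟨f, ?_⟩
    change t < cosetPushforward hH ν f.1 x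
    rw [cosetPushforward_mk]
    refine (ENNReal.ofReal_lt_ofReal_iff_of_nonneg ht.le).1 (htC.trans_le ?_)
    refine (integrable_slice hH f.1 x).measure_le_integral
      (Eventually.of_forall fun h => f.2.1 _) fun h hh => ?_
    exact (hφ1 ⟨h, hh, rfl⟩).ge
  · rw [mul_comm, ← ENNReal.le_div_iff_mul_le (by simp [ht]) (by simp)]
    rw [(isOpen_iUnion hV).measure_eq_iSup_isCompact]
    refine iSup₂_le fun K hKV => iSup_le fun hK => ?_
    obtain ⟨f, hf⟩ : ∃ f : F, K ⊆ V f := by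
      have : Nonempty F := ⟨⟨0, by simp⟩⟩
      exact hK.elim_directed_cover V hV hKV hdir
    rw [ENNReal.le_div_iff_mul_le (by simp [ht]) (by simp), mul_comm]
    have hint : Integrable (cosetPushforward hH ν f.1) lam :=
      (cosetPushforward hH ν f.1).continuous.integrable_of_hasCompactSupport
        (cosetPushforward hH ν f.1).hasCompactSupport
    have hnn : ∀ q, 0 ≤ cosetPushforward hH ν f.1 q := fun q => by
      have := hmono 0 f.1 (fun x => f.2.1 x) q
      simpa using this
    have h1 : t⁻¹ * (k * ∫ x, f.1 x ∂μ) = ∫ q, t⁻¹ * cosetPushforward hH ν f.1 q ∂lam := by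
      rw [integral_const_mul, hk]
    have h2 : lam K ≤ ENNReal.ofReal (t⁻¹ * (k * ∫ x, f.1 x ∂μ)) := by
      rw [h1]
      refine (hint.const_mul _).measure_le_integral
        (Eventually.of_forall fun q => mul_nonneg (by positivity) (hnn q)) fun q hq => ?_
      rw [← div_eq_inv_mul, one_le_div ht]
      exact (hf hq : t < _).le
    have h3 : ENNReal.ofReal (∫ x, f.1 x ∂μ) ≤ μ U :=
      integral_le_measure (fun x _ => f.2.2.1 x) fun x hx => (f.2.2.2 x hx).le
    calc ENNReal.ofReal t * lam K
        ≤ ENNReal.ofReal t * ENNReal.ofReal (t⁻¹ * (k * ∫ x, f.1 x ∂μ)) := by gcongr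
      _ = ENNReal.ofReal k * ENNReal.ofReal (∫ x, f.1 x ∂μ) := by
          rw [← ENNReal.ofReal_mul ht.le, ← ENNReal.ofReal_mul hk0.le]
          congr 1
          field_simp
      _ ≤ _ := by gcongr

/-- Almost every slice, along the cosets, of a null set is a null set. -/
lemma ae_slice_of_ae [ν.Regular] (hH : IsClosed (H : Set G)) {p : G → Prop} (hp : ∀ᵐ x ∂μ, p x) :
    ∀ᵐ q ∂lam, ∀ x : G, (x : G ⧸ H) = q → ∀ᵐ h : H ∂ν, p (x * h) := by
  obtain ⟨k, hk0, hk⟩ := exists_integral_cosetPushforward_eq_real hH μ ν lam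
  -- E n j contains the cosets whose bad slice exceeds 1/(n+1), estimated through an open cover of
  -- the null set of measure at most 1/(j+1). Letting j grow makes the intersection null for each n.
  have hex : ∀ n j : ℕ, ∃ E : Set (G ⧸ H),
      (∀ x : G, ENNReal.ofReal (n + 1 : ℝ)⁻¹ < ν {h : H | ¬ p (x * h)} → (x : G ⧸ H) ∈ E) ∧
        ENNReal.ofReal (n + 1 : ℝ)⁻¹ * lam E ≤ ENNReal.ofReal k * (j + 1 : ℝ≥0∞)⁻¹ := by
    intro n j
    obtain ⟨U, hNU, hU, hmU⟩ := Set.exists_isOpen_le_add {x | ¬ p x} μ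
      (ε := (j + 1 : ℝ≥0∞)⁻¹) (ENNReal.inv_ne_zero.2 (by finiteness))
    obtain ⟨E, hE1, hE2⟩ := exists_isOpen_mul_measure_le hH hk0 hk hU (t := (n + 1 : ℝ)⁻¹)
      (by positivity)
    refine ⟨E, fun x hx => hE1 x (hx.trans_le (measure_mono fun h hh => hNU hh)), hE2.trans ?_⟩
    gcongr
    refine hmU.trans ?_
    rw [ae_iff.1 hp, zero_add]
  choose E hE1 hE2 using hex
  have hnull : ∀ n, lam (⋂ j, E n j) = 0 := by
    intro n
    have h0 : ENNReal.ofReal (n + 1 : ℝ)⁻¹ * lam (⋂ j, E n j) = 0 := by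
      refine le_antisymm (ge_of_tendsto' (f := fun j : ℕ => ENNReal.ofReal k * (j + 1 : ℝ≥0∞)⁻¹)
          (x := atTop) ?_ fun j => ?_) zero_le
      · have := ENNReal.Tendsto.const_mul (a := ENNReal.ofReal k)
          (ENNReal.tendsto_inv_nat_nhds_zero.comp (tendsto_add_atTop_nat 1)) (by simp)
        simpa [Function.comp_def] using this
      · refine le_trans ?_ (hE2 n j)
        gcongr
        exact Set.iInter_subset _ j
    refine (mul_eq_zero.1 h0).resolve_left ?_
    simp only [ENNReal.ofReal_eq_zero, not_le]
    positivity
  have hnull' : ∀ᵐ q ∂lam, q ∉ ⋃ n, ⋂ j, E n j :=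
    measure_eq_zero_iff_ae_notMem.1 (measure_iUnion_null hnull)
  filter_upwards [hnull'] with q hq x hxq
  by_contra hcon
  refine hq ?_
  subst hxq
  rw [ae_iff, ← ne_eq, ← pos_iff_ne_zero] at hcon
  obtain ⟨n, hn⟩ := ENNReal.exists_inv_nat_lt hcon.ne'
  refine Set.mem_iUnion.2 ⟨n, Set.mem_iInter.2 fun j => hE1 n j x (lt_of_le_of_lt ?_ hn)⟩
  rw [ENNReal.ofReal_inv_of_pos (by positivity)]
  gcongr
  rw [ENNReal.ofReal_add (by positivity) (by positivity)]
  simp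

end Weil

/-! ### Convolution, null sets under inversion, and series of convolutions. -/

section Convolution

variable {G : Type*} [Group G] [TopologicalSpace G] [IsTopologicalGroup G]
  [LocallyCompactSpace G] [T2Space G] [MeasurableSpace G] [BorelSpace G]
  {μ : Measure G} [μ.IsHaarMeasure]

/-- The inverse of a null set for a regular Haar measure is a null set. -/
lemma ae_inv_of_ae [μ.Regular] {p : G → Prop} (hp : ∀ᵐ x ∂μ, p x) : ∀ᵐ x ∂μ, p x⁻¹ := by
  obtain ⟨⟨g, hg⟩, hgc, hg0, hg1⟩ :
    ∃ g : C(G, ℝ), HasCompactSupport g ∧ 0 ≤ g ∧ g 1 ≠ 0 := exists_continuous_nonneg_pos 1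
  have hI : 0 < ∫ x, g x ∂μ := hg.integral_pos_of_hasCompactSupport_nonneg_nonzero hgc hg0 hg1
  -- Uniqueness of Haar measure, comparing the left invariant μ with the right invariant `μ.inv`,
  -- shows that μ has density proportional to D⁻¹ with respect to `μ.inv`, at least against C_c
  -- functions.
  set D : G → ℝ := fun y => ∫ z, g (z⁻¹ * y) ∂μ.inv with hD
  have hDc : Continuous D := continuous_integral_apply_inv_mul hg hgc
  have hDpos : ∀ x, 0 < D x := by
    intro x
    have hc : Continuous fun y => g (y⁻¹ * x) := by fun_prop
    refine hc.integral_pos_of_hasCompactSupport_nonneg_nonzero ?_ (fun y => hg0 _) (x := x)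
      (by simpa using hg1)
    exact hgc.comp_homeomorph ((Homeomorph.inv G).trans (Homeomorph.mulRight x))
  have hDi : Continuous fun x => (D x)⁻¹ := hDc.inv₀ fun x => (hDpos x).ne'
  have hcombo : ∀ f : G → ℝ, Continuous f → HasCompactSupport f →
      ∫ x, f x⁻¹ * (D x⁻¹)⁻¹ ∂μ = (∫ x, g x ∂μ)⁻¹ * ∫ x, f x ∂μ := by
    intro f hf hfc
    rw [Measure.integral_isMulLeftInvariant_isMulRightInvariant_combo (μ := μ) (ν := μ.inv) hf hfc
      hg hgc hg0 hg1, mul_comm (∫ y, _ ∂μ.inv), inv_mul_cancel_left₀ hI.ne', Measure.inv,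
      integral_map (by fun_prop)]
    · rfl
    exact ((hf.mul hDi).stronglyMeasurable_of_hasCompactSupport
      hfc.mul_right).aestronglyMeasurable
  -- Where the density is bounded below by s, inversion increases the measure of open sets at most
  -- by a constant factor. As D⁻¹ is positive and continuous, the open sets {D⁻¹ > 1/(n+1)} exhaust
  -- G.
  have hopen : ∀ (U : Set G) (s : ℝ), 0 < s → IsOpen U → (∀ x ∈ U, s < (D x)⁻¹) →
      μ U⁻¹ ≤ ENNReal.ofReal (s⁻¹ * (∫ x, g x ∂μ)⁻¹) * μ U := by
    intro U s hs hU hUs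
    rw [hU.inv.measure_eq_iSup_isCompact]
    refine iSup₂_le fun K hKU => iSup_le fun hK => ?_
    obtain ⟨φ, hφ1, hφ0, hφc, hφ⟩ := exists_continuous_one_zero_of_isCompact hK.inv
      hU.isClosed_compl (Set.disjoint_compl_right_iff_subset.2 (Set.inv_subset.2 hKU))
    have hint : Integrable (fun x => s⁻¹ * (φ x⁻¹ * (D x⁻¹)⁻¹)) μ := by
      refine Continuous.integrable_of_hasCompactSupport ?_ ?_
      · exact continuous_const.mul ((φ.continuous.mul hDi).comp continuous_inv)
      · exact HasCompactSupport.mul_left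
          ((hφc.comp_homeomorph (Homeomorph.inv G)).mul_right)
    have h1 : μ K ≤ ENNReal.ofReal (∫ x, s⁻¹ * (φ x⁻¹ * (D x⁻¹)⁻¹) ∂μ) := by
      refine hint.measure_le_integral (Eventually.of_forall fun x => ?_) fun x hx => ?_
      · have := (hφ x⁻¹).1
        have := hDpos x⁻¹
        positivity
      · have h2 : x⁻¹ ∈ U := by simpa using hKU hx
        have h3 : φ x⁻¹ = 1 := hφ1 (by simpa using hx)
        rw [h3, one_mul, ← div_eq_inv_mul, one_le_div hs]
        exact (hUs _ h2).le
    rw [integral_const_mul, hcombo φ φ.continuous hφc, ← mul_assoc,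
      ENNReal.ofReal_mul (by positivity)] at h1
    refine h1.trans ?_
    gcongr
    exact integral_le_measure (fun x _ => (hφ x).2) fun x hx => (hφ0 hx).le
  have hnull : ∀ n : ℕ, μ {x | ¬ p x⁻¹ ∧ (n + 1 : ℝ)⁻¹ < (D x⁻¹)⁻¹} = 0 := by
    intro n
    set C := ENNReal.ofReal ((n + 1 : ℝ)⁻¹⁻¹ * (∫ x, g x ∂μ)⁻¹)
    refine le_antisymm (ge_of_tendsto' (f := fun j : ℕ => C * (j + 1 : ℝ≥0∞)⁻¹)
          (x := atTop) ?_ fun j => ?_) zero_le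
    · have := ENNReal.Tendsto.const_mul (a := C)
        (ENNReal.tendsto_inv_nat_nhds_zero.comp (tendsto_add_atTop_nat 1)) (by simp [C])
      simpa [Function.comp_def] using this
    · obtain ⟨U, hNU, hU, hmU⟩ := Set.exists_isOpen_le_add {x | ¬ p x} μ
        (ε := (j + 1 : ℝ≥0∞)⁻¹) (ENNReal.inv_ne_zero.2 (by finiteness))
      rw [ae_iff.1 hp, zero_add] at hmU
      have hV := hopen (U ∩ {x | (n + 1 : ℝ)⁻¹ < (D x)⁻¹}) (n + 1 : ℝ)⁻¹ (by positivity)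
        (hU.inter (isOpen_lt continuous_const hDi)) fun x hx => hx.2
      refine (measure_mono ?_).trans (hV.trans ?_)
      · exact fun x hx => ⟨hNU hx.1, hx.2⟩
      · gcongr
        exact (measure_mono Set.inter_subset_left).trans hmU
  rw [ae_iff]
  refine measure_mono_null (fun x hx => ?_) (measure_iUnion_null hnull)
  have hpos : 0 < (D x⁻¹)⁻¹ := inv_pos.2 (hDpos _)
  obtain ⟨n, hn⟩ := exists_nat_one_div_lt hpos
  exact Set.mem_iUnion.2 ⟨n, hx, by simpa using hn⟩

section

open scoped Pointwise

variable {𝕜 : Type*} [RCLike 𝕜]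

lemma continuous_hasCompactSupport_conv (f g : C_c(G, 𝕜)) :
    Continuous (fun x => ∫ y, f y * g (y⁻¹ * x) ∂μ) ∧
      HasCompactSupport (fun x => ∫ y, f y * g (y⁻¹ * x) ∂μ) := by
  constructor
  · rw [← continuousOn_univ]
    refine continuousOn_integral_of_compact_support (k := tsupport f) f.hasCompactSupport ?_ ?_
    · exact Continuous.continuousOn (by fun_prop)
    · intro x y _ hy
      simp [image_eq_zero_of_notMem_tsupport hy]
  · refine HasCompactSupport.intro (K := tsupport f * tsupport g)
      (f.hasCompactSupport.isCompact.mul g.hasCompactSupport.isCompact) fun x hx => ?_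
    refine integral_eq_zero_of_ae (Eventually.of_forall fun y => ?_)
    by_cases hy : y ∈ tsupport f
    · have : y⁻¹ * x ∉ tsupport g := fun h => hx ⟨y, hy, y⁻¹ * x, h, by simp⟩
      simp [image_eq_zero_of_notMem_tsupport this]
    · simp [image_eq_zero_of_notMem_tsupport hy]

variable (μ) in
/-- The convolution of compactly supported continuous functions. -/
noncomputable def CompactlySupportedContinuousMap.conv (f g : C_c(G, 𝕜)) : C_c(G, 𝕜) :=
  ⟨⟨fun x => ∫ y, f y * g (y⁻¹ * x) ∂μ, (continuous_hasCompactSupport_conv f g).1⟩,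
    (continuous_hasCompactSupport_conv f g).2⟩

lemma CompactlySupportedContinuousMap.conv_apply (f g : C_c(G, 𝕜)) (x : G) :
    f.conv μ g x = ∫ y, f y * g (y⁻¹ * x) ∂μ := rfl

/-- The integrand is continuous with compact support on G × G, so the order of integration can be
exchanged without σ-finiteness. -/
lemma CompactlySupportedContinuousMap.integral_conv (f g : C_c(G, 𝕜)) :
    ∫ x, f.conv μ g x ∂μ = (∫ x, f x ∂μ) * ∫ x, g x ∂μ := by
  simp only [CompactlySupportedContinuousMap.conv_apply]
  rw [integral_integral_swap_of_hasCompactSupport (f := fun x y => f y * g (y⁻¹ * x))]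
  · simp_rw [integral_const_mul, integral_mul_left_eq_self (fun x => g x), integral_mul_const]
  · simp only [Function.uncurry_def]
    fun_prop
  · refine HasCompactSupport.intro (K := (tsupport f * tsupport g) ×ˢ tsupport f)
      ((f.hasCompactSupport.isCompact.mul g.hasCompactSupport.isCompact).prod
        f.hasCompactSupport.isCompact) ?_
    rintro ⟨x, y⟩ hxy
    simp only [Function.uncurry_apply_pair]
    by_cases hy : y ∈ tsupport f
    · have : y⁻¹ * x ∉ tsupport g := fun h => hxy ⟨⟨y, hy, y⁻¹ * x, h, by simp⟩, hy⟩
      simp [image_eq_zero_of_notMem_tsupport this]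
    · simp [image_eq_zero_of_notMem_tsupport hy]

end

variable (μ) in
/-- The convolution of the absolute values of two functions. -/
noncomputable def absConv (f g : G → ℂ) (x : G) : ℝ≥0∞ := ∫⁻ y, ‖f y‖ₑ * ‖g (y⁻¹ * x)‖ₑ ∂μ

lemma enorm_groupConv_le (f g : G → ℂ) (x : G) : ‖groupConv μ f g x‖ₑ ≤ absConv μ f g x := by
  refine (enorm_integral_le_lintegral_enorm _).trans (le_of_eq ?_)
  simp only [enorm_mul, absConv]

/-- The equality holds at every point: for each fixed x the map y ↦ y⁻¹x pulls null sets back to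
null sets, by `ae_inv_of_ae`. -/
lemma groupConv_congr_ae [μ.Regular] {f f' g g' : G → ℂ} (hf : f =ᵐ[μ] f') (hg : g =ᵐ[μ] g') :
    groupConv μ f g = groupConv μ f' g' := by
  ext x
  refine integral_congr_ae ?_
  have h2 : ∀ᵐ y ∂μ, g (y⁻¹ * x) = g' (y⁻¹ * x) := by
    have := (measurePreserving_mul_left μ x⁻¹).quasiMeasurePreserving.ae (ae_inv_of_ae hg)
    simpa using this
  filter_upwards [hf, h2] with y h1 h2
  simp [h1, h2]

/-- At a point where the absolute convolutions of all pairs are summable, the double series can be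
integrated term by term; almost everywhere in y its sum is the product of the two sums. -/
lemma hasSum_groupConv [μ.Regular] {ι κ : Type*} [Countable ι] [Countable κ]
    {u : ι → C_c(G, ℂ)} {v : κ → C_c(G, ℂ)} {f g : G → ℂ}
    (hf : ∀ᵐ y ∂μ, HasSum (fun i => u i y) (f y)) (hg : ∀ᵐ y ∂μ, HasSum (fun i => v i y) (g y))
    {x : G} (hx : ∑' i : ι × κ, absConv μ (u i.1) (v i.2) x ≠ ⊤) :
    HasSum (fun i : ι × κ => groupConv μ (u i.1) (v i.2) x) (groupConv μ f g x) := by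
  have hcs : ∀ i : ι × κ, Continuous (fun y => u i.1 y * v i.2 (y⁻¹ * x)) ∧
      HasCompactSupport (fun y => u i.1 y * v i.2 (y⁻¹ * x)) := fun i =>
    ⟨by fun_prop, (u i.1).hasCompactSupport.mul_right⟩
  have hg' : ∀ᵐ y ∂μ, HasSum (fun i => v i (y⁻¹ * x)) (g (y⁻¹ * x)) := by
    have := (measurePreserving_mul_left μ x⁻¹).quasiMeasurePreserving.ae (ae_inv_of_ae hg)
    simpa using this
  have hm : ∀ i : ι × κ, AEStronglyMeasurable (fun y => u i.1 y * v i.2 (y⁻¹ * x)) μ := fun i =>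
    ((hcs i).1.stronglyMeasurable_of_hasCompactSupport (hcs i).2).aestronglyMeasurable
  have hs : ∑' i : ι × κ, ∫⁻ y, ‖u i.1 y * v i.2 (y⁻¹ * x)‖ₑ ∂μ ≠ ⊤ := by
    simpa only [enorm_mul, absConv] using hx
  have hae : ∀ᵐ y ∂μ, HasSum (fun i : ι × κ => u i.1 y * v i.2 (y⁻¹ * x))
      (f y * g (y⁻¹ * x)) := by
    filter_upwards [hf, hg', ae_summable_norm_of_tsum_lintegral_ne_top hm hs] with y h1 h2 h3
    have h4 : Summable fun i : ι × κ => u i.1 y * v i.2 (y⁻¹ * x) := h3.of_norm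
    exact HasSum.mul (f := fun i => u i y) (g := fun j => v j (y⁻¹ * x)) h1 h2 h4
  have key := hasSum_integral_of_summable_integral_norm (μ := μ)
    (F := fun (i : ι × κ) y => u i.1 y * v i.2 (y⁻¹ * x))
    (fun i => (hcs i).1.integrable_of_hasCompactSupport (hcs i).2) ?_
  · have h5 : groupConv μ f g x = ∫ y, ∑' i : ι × κ, u i.1 y * v i.2 (y⁻¹ * x) ∂μ := ?_
    · rw [h5]
      exact key
    refine integral_congr_ae ?_
    filter_upwards [hae] with y hy
    exact hy.tsum_eq.symm
  · simp only [integral_norm_eq_lintegral_enorm (hm _)]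
    exact ENNReal.summable_toReal hs

/-- This takes the place of Tonelli's theorem: finiteness of the double sum of integrals gives
finiteness of the double series at almost every x. It also yields integrability of the convolution.
-/
lemma isL1Series_groupConv [μ.Regular] {ι κ : Type*} [Countable ι] [Countable κ]
    {u : ι → C_c(G, ℂ)} {v : κ → C_c(G, ℂ)} {f g : G → ℂ}
    (hf : ∀ᵐ y ∂μ, HasSum (fun i => u i y) (f y)) (hg : ∀ᵐ y ∂μ, HasSum (fun i => v i y) (g y))
    {m : Measure G} (hm : ∀ i j, AEMeasurable (absConv μ (u i) (v j)) m)
    (hs : ∑' i : ι × κ, ∫⁻ x, absConv μ (u i.1) (v i.2) x ∂m ≠ ⊤) :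
    IsL1Series m (fun i : ι × κ => groupConv μ (u i.1) (v i.2)) (groupConv μ f g) where
  aestronglyMeasurable i :=
    (((u i.1).conv μ (v i.2)).continuous.stronglyMeasurable_of_hasCompactSupport
      ((u i.1).conv μ (v i.2)).hasCompactSupport).aestronglyMeasurable
  tsum_ne_top := ne_top_of_le_ne_top hs
    (ENNReal.tsum_le_tsum fun i => lintegral_mono fun x => enorm_groupConv_le _ _ x)
  ae_hasSum := by
    rw [← lintegral_tsum fun i : ι × κ => hm i.1 i.2] at hs
    filter_upwards [ae_lt_top' (AEMeasurable.tsum fun i : ι × κ => hm i.1 i.2) hs] with x hx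
    exact hasSum_groupConv hf hg hx.ne

end Convolution

/-! ### Absolute values and weights on compactly supported functions. -/

section CompactlySupported

variable {X : Type*} [TopologicalSpace X]

/-- The absolute value of a compactly supported continuous function. -/
noncomputable def CompactlySupportedContinuousMap.absC (f : C_c(X, ℂ)) : C_c(X, ℝ) :=
  ⟨⟨fun x => ‖f x‖, by fun_prop⟩, f.hasCompactSupport.norm⟩

lemma CompactlySupportedContinuousMap.absC_apply (f : C_c(X, ℂ)) (x : X) : f.absC x = ‖f x‖ := rfl

lemma CompactlySupportedContinuousMap.absC_nonneg (f : C_c(X, ℂ)) (x : X) : 0 ≤ f.absC x :=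
  norm_nonneg (f x)

lemma CompactlySupportedContinuousMap.integrable' {E : Type*} [NormedAddCommGroup E]
    [MeasurableSpace X] [OpensMeasurableSpace X] {m : Measure X} [IsFiniteMeasureOnCompacts m]
    (f : C_c(X, E)) : Integrable f m :=
  f.continuous.integrable_of_hasCompactSupport f.hasCompactSupport

/-- The product of a continuous weight and a compactly supported continuous function. -/
def CompactlySupportedContinuousMap.weightMul {w : X → ℝ} (hw : Continuous w) (f : C_c(X, ℝ)) :
    C_c(X, ℝ) :=
  ⟨⟨fun x => w x * f x, by fun_prop⟩, f.hasCompactSupport.mul_left⟩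

lemma CompactlySupportedContinuousMap.weightMul_apply {w : X → ℝ} (hw : Continuous w)
    (f : C_c(X, ℝ)) (x : X) : f.weightMul hw x = w x * f x := rfl

lemma lintegral_weightedMeasure_ofReal [MeasurableSpace X] [BorelSpace X] {m : Measure X}
    [IsFiniteMeasureOnCompacts m] {w : X → ℝ} (hw : Continuous w) (hw0 : ∀ x, 0 < w x)
    {f : C_c(X, ℝ)} (hf : ∀ x, 0 ≤ f x) :
    ∫⁻ x, ENNReal.ofReal (f x) ∂weightedMeasure m w
      = ENNReal.ofReal (∫ x, f.weightMul hw x ∂m) := by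
  rw [lintegral_weightedMeasure hw.measurable, ofReal_integral_eq_lintegral_ofReal
    (f.weightMul hw).integrable' (Eventually.of_forall fun x => mul_nonneg (hw0 x).le (hf x))]
  simp only [CompactlySupportedContinuousMap.weightMul_apply, ENNReal.ofReal_mul (hw0 _).le]

end CompactlySupported

/-! ### Submultiplicativity of the weighted norm on C_c. -/

section AbsConv

variable {G : Type*} [Group G] [TopologicalSpace G] [IsTopologicalGroup G]
  [LocallyCompactSpace G] [T2Space G] [MeasurableSpace G] [BorelSpace G]
  {μ : Measure G} [μ.IsHaarMeasure]

lemma integrable_conv {𝕜 : Type*} [RCLike 𝕜] (f g : C_c(G, 𝕜)) (x : G) :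
    Integrable (fun y => f y * g (y⁻¹ * x)) μ :=
  Continuous.integrable_of_hasCompactSupport (by fun_prop) f.hasCompactSupport.mul_right

lemma conv_nonneg {f g : C_c(G, ℝ)} (hf : ∀ x, 0 ≤ f x) (hg : ∀ x, 0 ≤ g x) (x : G) :
    0 ≤ f.conv μ g x :=
  integral_nonneg fun _ => mul_nonneg (hf _) (hg _)

lemma absConv_le_ofReal_conv {f g : C_c(G, ℂ)} {F K : C_c(G, ℝ)} (hF : ∀ x, ‖f x‖ ≤ F x)
    (hK : ∀ x, ‖g x‖ ≤ K x) (x : G) : absConv μ f g x ≤ ENNReal.ofReal (F.conv μ K x) := by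
  have hF0 : ∀ x, 0 ≤ F x := fun x => (norm_nonneg _).trans (hF x)
  have hK0 : ∀ x, 0 ≤ K x := fun x => (norm_nonneg _).trans (hK x)
  rw [CompactlySupportedContinuousMap.conv_apply, ofReal_integral_eq_lintegral_ofReal
    (integrable_conv F K x) (Eventually.of_forall fun y => mul_nonneg (hF0 _) (hK0 _))]
  refine lintegral_mono fun y => ?_
  rw [ENNReal.ofReal_mul (hF0 _), ← ofReal_norm, ← ofReal_norm]
  gcongr
  · exact hF _
  · exact hK _

lemma absConv_eq_ofReal_conv (f g : C_c(G, ℂ)) (x : G) :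
    absConv μ f g x = ENNReal.ofReal (f.absC.conv μ g.absC x) := by
  rw [CompactlySupportedContinuousMap.conv_apply, ofReal_integral_eq_lintegral_ofReal
    (integrable_conv _ _ x) (Eventually.of_forall fun y => mul_nonneg (f.absC_nonneg _)
      (g.absC_nonneg _))]
  refine lintegral_congr fun y => ?_
  rw [ENNReal.ofReal_mul (f.absC_nonneg _), CompactlySupportedContinuousMap.absC_apply,
    CompactlySupportedContinuousMap.absC_apply, ofReal_norm, ofReal_norm]

lemma measurable_absConv (f g : C_c(G, ℂ)) : Measurable (absConv μ f g) := by
  have : absConv μ f g = fun x => ENNReal.ofReal (f.absC.conv μ g.absC x) :=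
    funext (absConv_eq_ofReal_conv f g)
  rw [this]
  exact (f.absC.conv μ g.absC).continuous.measurable.ennreal_ofReal

/-- From ω(x) ≤ ω(y) ω(y⁻¹x) one gets ω(|f| * |g|) ≤ (ω|f|) * (ω|g|) pointwise, and the integral of
the right side is a product. -/
lemma lintegral_absConv_le {ω : G → ℝ} (hω : IsWeight ω) (f g : C_c(G, ℂ)) :
    ∫⁻ x, absConv μ f g x ∂weightedMeasure μ ω ≤
      (∫⁻ x, ‖f x‖ₑ ∂weightedMeasure μ ω) * ∫⁻ x, ‖g x‖ₑ ∂weightedMeasure μ ω := by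
  have habs : ∀ f : C_c(G, ℂ), ∫⁻ x, ‖f x‖ₑ ∂weightedMeasure μ ω =
      ENNReal.ofReal (∫ x, f.absC.weightMul hω.continuous x ∂μ) := fun f => by
    rw [← lintegral_weightedMeasure_ofReal hω.continuous hω.pos fun x => norm_nonneg (f x)]
    simp only [CompactlySupportedContinuousMap.absC_apply, ofReal_norm]
  have hw0 : ∀ (f : C_c(G, ℂ)) x, 0 ≤ f.absC.weightMul hω.continuous x := fun f x =>
    mul_nonneg (hω.pos x).le (f.absC_nonneg x)
  simp only [absConv_eq_ofReal_conv]
  rw [lintegral_weightedMeasure_ofReal hω.continuous hω.pos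
    (conv_nonneg (fun x => norm_nonneg (f x)) fun x => norm_nonneg (g x)), habs, habs,
    ← ENNReal.ofReal_mul (integral_nonneg (hw0 f)), ← CompactlySupportedContinuousMap.integral_conv]
  refine ENNReal.ofReal_le_ofReal (integral_mono (CompactlySupportedContinuousMap.integrable' _)
    (CompactlySupportedContinuousMap.integrable' _) fun x => ?_)
  change ω x * ∫ y, _ ∂μ ≤ ∫ y, _ ∂μ
  rw [← integral_const_mul]
  refine integral_mono ((integrable_conv f.absC g.absC x).const_mul _)
    (integrable_conv _ _ x) fun y => ?_
  simp only [CompactlySupportedContinuousMap.weightMul_apply,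
    CompactlySupportedContinuousMap.absC_apply]
  have h1 := hω.submul y (y⁻¹ * x)
  rw [mul_inv_cancel_left] at h1
  calc ω x * (‖f y‖ * ‖g (y⁻¹ * x)‖) ≤ (ω y * ω (y⁻¹ * x)) * (‖f y‖ * ‖g (y⁻¹ * x)‖) := by gcongr
    _ = _ := by ring

end AbsConv

/-! ### The induced weight. -/

section QuotientWeight

variable {G : Type*} [Group G] {H : Subgroup G} {ω : G → ℝ}

lemma quotientWeight_mk_le (hpos : ∀ x, 0 < ω x) (x : G) : quotientWeight H ω x ≤ ω x :=
  csInf_le ⟨0, by rintro _ ⟨y, -, rfl⟩; exact (hpos y).le⟩ ⟨x, rfl, rfl⟩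

lemma quotientWeight_nonempty (q : G ⧸ H) : (ω '' {x : G | (x : G ⧸ H) = q}).Nonempty := by
  induction q using QuotientGroup.induction_on with
  | H x => exact ⟨ω x, x, rfl, rfl⟩

lemma le_quotientWeight {δ : ℝ} (hδ : ∀ x, δ ≤ ω x) (q : G ⧸ H) : δ ≤ quotientWeight H ω q :=
  le_csInf (quotientWeight_nonempty q) (by rintro _ ⟨y, -, rfl⟩; exact hδ y)

lemma exists_lt_of_quotientWeight_lt {q : G ⧸ H} {c : ℝ} (h : quotientWeight H ω q < c) :
    ∃ x : G, (x : G ⧸ H) = q ∧ ω x < c := by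
  obtain ⟨_, ⟨x, hx, rfl⟩, hxc⟩ := exists_lt_of_csInf_lt (quotientWeight_nonempty q) h
  exact ⟨x, hx, hxc⟩

/-- The set {ω̂ < c} is the image of the open set {ω < c} under the open quotient map. -/
lemma upperSemicontinuous_quotientWeight [TopologicalSpace G] [IsTopologicalGroup G]
    (hc : Continuous ω) (hpos : ∀ x, 0 < ω x) : UpperSemicontinuous (quotientWeight H ω) := by
  rw [upperSemicontinuous_iff_isOpen_preimage]
  intro c
  have : quotientWeight H ω ⁻¹' Set.Iio c = ((↑) : G → G ⧸ H) '' {x | ω x < c} := by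
    ext q
    constructor
    · intro h
      obtain ⟨x, hx, hxc⟩ := exists_lt_of_quotientWeight_lt h
      exact ⟨x, hxc, hx⟩
    · rintro ⟨x, hx, rfl⟩
      exact (quotientWeight_mk_le hpos x).trans_lt hx
  rw [this]
  exact QuotientGroup.isOpenMap_coe _ (isOpen_lt hc continuous_const)

lemma quotientWeight_mul_le [H.Normal] (hpos : ∀ x, 0 < ω x)
    (hsub : ∀ x y, ω (x * y) ≤ ω x * ω y) (u : G) (q : G ⧸ H) :
    quotientWeight H ω (u * q) ≤ ω u * quotientWeight H ω q := by
  refine le_of_forall_gt_imp_ge_of_dense fun c hc => ?_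
  have h1 : quotientWeight H ω q < c / ω u := by
    rwa [lt_div_iff₀ (hpos u), mul_comm]
  obtain ⟨x, rfl, hx⟩ := exists_lt_of_quotientWeight_lt h1
  rw [← QuotientGroup.mk_mul]
  refine (quotientWeight_mk_le hpos _).trans ((hsub u x).trans ?_)
  rw [lt_div_iff₀ (hpos u), mul_comm] at hx
  exact hx.le

end QuotientWeight

/-! ### Coset integration on C_c: convolution and norm estimates. -/

section CosetPushforward

open scoped Pointwise

variable {G : Type*} [Group G] [TopologicalSpace G] [IsTopologicalGroup G]
  [LocallyCompactSpace G] [T2Space G] [MeasurableSpace G] [BorelSpace G]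
  {H : Subgroup G} [H.Normal] {hH : IsClosed (H : Set G)}
  [MeasurableSpace (G ⧸ H)] [BorelSpace (G ⧸ H)]
  {μ : Measure G} [μ.IsHaarMeasure]
  {ν : Measure H} [ν.IsHaarMeasure]
  {lam : Measure (G ⧸ H)} [lam.IsHaarMeasure]

/-- Integration over cosets maps convolutions to convolutions, up to the normalization `k` of the
Haar measures. -/
lemma smul_cosetPushforward_conv [T2Space (G ⧸ H)] {𝕜 : Type*} [RCLike 𝕜] {k : ℝ}
    (hk : ∀ f : C_c(G, 𝕜), ∫ q, cosetPushforward hH ν f q ∂lam = k • ∫ x, f x ∂μ)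
    (f g : C_c(G, 𝕜)) (q : G ⧸ H) :
    k • cosetPushforward hH ν (f.conv μ g) q =
      (cosetPushforward hH ν f).conv lam (cosetPushforward hH ν g) q := by
  induction q using QuotientGroup.induction_on with
  | H x =>
    have hc : Continuous fun y : G => (y : G ⧸ H)⁻¹ * (x : G ⧸ H) := by
      have := QuotientGroup.continuous_mk (N := H)
      fun_prop
    -- The second factor is constant on cosets of H, so TF(p) = Tf(p) Tg(p⁻¹x). Integrating F over G
    -- gives T(f * g)(x) by exchanging integrals, and Weil's formula for F turns k times this into
    -- (Tf * Tg)(x).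
    let F : C_c(G, 𝕜) := ⟨⟨fun y => f y * cosetPushforward hH ν g ((y : G ⧸ H)⁻¹ * (x : G ⧸ H)),
      f.continuous.mul ((cosetPushforward hH ν g).continuous.comp hc)⟩, f.hasCompactSupport.mul_right⟩
    have hF : ∀ y, F y = f y * ∫ h : H, g (y⁻¹ * x * h) ∂ν := fun y => by
      rw [← cosetPushforward_mk hH]
      rfl
    have hTF : ∀ p, cosetPushforward hH ν F p =
        cosetPushforward hH ν f p * cosetPushforward hH ν g (p⁻¹ * x) := fun p => by
      induction p using QuotientGroup.induction_on with
      | H z =>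
        rw [cosetPushforward_mk, cosetPushforward_mk, ← integral_mul_const]
        congr 1 with h
        change f (z * h) * cosetPushforward hH ν g (((z * h : G) : G ⧸ H)⁻¹ * x) = _
        rw [QuotientGroup.mk_mul_of_mem z h.2]
    have hswap : cosetPushforward hH ν (f.conv μ g) (x : G ⧸ H) = ∫ y, F y ∂μ := by
      rw [cosetPushforward_mk]
      simp only [CompactlySupportedContinuousMap.conv_apply, hF]
      rw [integral_integral_swap_of_hasCompactSupport
        (f := fun (h : H) y => f y * g (y⁻¹ * (x * h)))]
      · simp only [integral_const_mul, mul_assoc]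
      · simp only [Function.uncurry_def]
        fun_prop
      · have hK : IsCompact (((↑) : H → G) ⁻¹' (({x⁻¹} : Set G) * (tsupport f * tsupport g))) :=
          hH.isClosedEmbedding_subtypeVal.isCompact_preimage (isCompact_singleton.mul
            (f.hasCompactSupport.isCompact.mul g.hasCompactSupport.isCompact))
        refine HasCompactSupport.intro (hK.prod f.hasCompactSupport.isCompact) ?_
        rintro ⟨h, y⟩ hy
        simp only [Function.uncurry_apply_pair]
        by_cases hyf : y ∈ tsupport f
        · have : y⁻¹ * (x * h) ∉ tsupport g := fun hg => hy
            ⟨⟨x⁻¹, rfl, x * h, ⟨y, hyf, _, hg, by simp⟩, by simp⟩, hyf⟩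
          simp [image_eq_zero_of_notMem_tsupport this]
        · simp [image_eq_zero_of_notMem_tsupport hyf]
    rw [hswap, ← hk, CompactlySupportedContinuousMap.conv_apply]
    exact integral_congr_ae (Eventually.of_forall hTF)

lemma cosetPushforward_nonneg {f : C_c(G, ℝ)} (hf : ∀ x, 0 ≤ f x) (q : G ⧸ H) :
    0 ≤ cosetPushforward hH ν f q := by
  induction q using QuotientGroup.induction_on with
  | H x => rw [cosetPushforward_mk]; exact integral_nonneg fun h => hf _

lemma norm_cosetPushforward_le (f : C_c(G, ℂ)) (q : G ⧸ H) :
    ‖cosetPushforward hH ν f q‖ ≤ cosetPushforward hH ν f.absC q := by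
  induction q using QuotientGroup.induction_on with
  | H x =>
    rw [cosetPushforward_mk, cosetPushforward_mk]
    exact norm_integral_le_integral_norm _

variable {ω : G → ℝ}

lemma quotientWeight_mul_cosetPushforward_le (hω : IsWeight ω) {f : C_c(G, ℝ)} (hf : ∀ x, 0 ≤ f x)
    (q : G ⧸ H) : quotientWeight H ω q * cosetPushforward hH ν f q ≤
      cosetPushforward hH ν (f.weightMul hω.continuous) q := by
  induction q using QuotientGroup.induction_on with
  | H x =>
    rw [cosetPushforward_mk, cosetPushforward_mk, ← integral_const_mul]
    refine integral_mono ((integrable_slice hH f x).const_mul _) (integrable_slice hH _ x)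
      fun h => ?_
    have h1 := quotientWeight_mk_le (H := H) hω.pos (x * h)
    rw [QuotientGroup.mk_mul_of_mem x h.2] at h1
    exact mul_le_mul_of_nonneg_right h1 (hf _)

lemma lintegral_cosetPushforward_le [T2Space (G ⧸ H)] (hω : IsWeight ω) {k : ℝ} (hk0 : 0 < k)
    (hk : ∀ f : C_c(G, ℝ), ∫ q, cosetPushforward hH ν f q ∂lam = k * ∫ x, f x ∂μ)
    {f : C_c(G, ℝ)} (hf : ∀ x, 0 ≤ f x) :
    ∫⁻ q, ENNReal.ofReal (cosetPushforward hH ν f q) ∂weightedMeasure lam (quotientWeight H ω) ≤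
      ENNReal.ofReal k * ∫⁻ x, ENNReal.ofReal (f x) ∂weightedMeasure μ ω := by
  have husc := upperSemicontinuous_quotientWeight (H := H) hω.continuous hω.pos
  rw [lintegral_weightedMeasure husc.measurable,
    lintegral_weightedMeasure_ofReal hω.continuous hω.pos hf, ← ENNReal.ofReal_mul hk0.le, ← hk,
    ofReal_integral_eq_lintegral_ofReal (CompactlySupportedContinuousMap.integrable' _)
      (Eventually.of_forall (cosetPushforward_nonneg fun x => mul_nonneg (hω.pos x).le (hf x)))]
  refine lintegral_mono fun q => ?_
  rw [← ENNReal.ofReal_mul (le_quotientWeight (fun x => (hω.pos x).le) q)]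
  exact ENNReal.ofReal_le_ofReal (quotientWeight_mul_cosetPushforward_le hω hf q)

lemma lintegral_enorm_cosetPushforward_le [T2Space (G ⧸ H)] (hω : IsWeight ω) {k : ℝ} (hk0 : 0 < k)
    (hk : ∀ f : C_c(G, ℝ), ∫ q, cosetPushforward hH ν f q ∂lam = k * ∫ x, f x ∂μ)
    (f : C_c(G, ℂ)) :
    ∫⁻ q, ENNReal.ofReal (cosetPushforward hH ν f.absC q)
        ∂weightedMeasure lam (quotientWeight H ω) ≤
      ENNReal.ofReal k * ∫⁻ x, ‖f x‖ₑ ∂weightedMeasure μ ω := by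
  refine (lintegral_cosetPushforward_le hω hk0 hk fun x => norm_nonneg (f x)).trans (le_of_eq ?_)
  simp only [CompactlySupportedContinuousMap.absC_apply, ofReal_norm]

/-- Use |Tf| * |Tg| ≤ T|f| * T|g| = k T(|f| * |g|). One factor k comes from this identity, the other
from the norm bound for T. -/
lemma lintegral_absConv_cosetPushforward_le [LocallyCompactSpace (G ⧸ H)] [T2Space (G ⧸ H)]
    (hω : IsWeight ω) {k : ℝ} (hk0 : 0 < k)
    (hk : ∀ f : C_c(G, ℝ), ∫ q, cosetPushforward hH ν f q ∂lam = k * ∫ x, f x ∂μ)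
    (f g : C_c(G, ℂ)) :
    ∫⁻ q, absConv lam (cosetPushforward hH ν f) (cosetPushforward hH ν g) q
        ∂weightedMeasure lam (quotientWeight H ω) ≤
      ENNReal.ofReal k * (ENNReal.ofReal k * ∫⁻ x, absConv μ f g x ∂weightedMeasure μ ω) := by
  simp only [absConv_eq_ofReal_conv f g]
  refine le_trans ?_ (mul_le_mul_right (lintegral_cosetPushforward_le (hH := hH) (ν := ν) hω hk0 hk
    (conv_nonneg (fun x => norm_nonneg (f x)) fun x => norm_nonneg (g x))) _)
  rw [← lintegral_const_mul' _ _ (by simp)]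
  refine lintegral_mono fun q => ?_
  rw [← ENNReal.ofReal_mul hk0.le]
  refine (absConv_le_ofReal_conv (norm_cosetPushforward_le f) (norm_cosetPushforward_le g) q).trans
    (le_of_eq ?_)
  rw [← smul_cosetPushforward_conv hk, smul_eq_mul]

end CosetPushforward

lemma IsL1Series.hasSum_integral {α ι : Type*} [MeasurableSpace α] {m : Measure α} [Countable ι]
    {u : ι → α → ℂ} {g : α → ℂ} (h : IsL1Series m u g) :
    HasSum (fun i => ∫ x, u i x ∂m) (∫ x, g x ∂m) := by
  have hfin : ∀ i, ∫⁻ x, ‖u i x‖ₑ ∂m ≠ ⊤ := ENNReal.ne_top_of_tsum_ne_top h.tsum_ne_top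
  have key := hasSum_integral_of_summable_integral_norm (μ := m) (F := u)
    (fun i => ⟨h.aestronglyMeasurable i, (hfin i).lt_top⟩) ?_
  · rwa [integral_congr_ae (h.ae_hasSum.mono fun x hx => hx.tsum_eq)] at key
  · simp only [integral_norm_eq_lintegral_enorm (h.aestronglyMeasurable _)]
    exact ENNReal.summable_toReal h.tsum_ne_top

/-! ### Representatives of elements of the weighted algebra. -/

namespace BeurlingAlgebra

variable {G : Type*} [MeasurableSpace G] {μ : Measure G} {ω : G → ℝ}

lemma memLp_toFun (f : BeurlingAlgebra μ ω) : MemLp f.toFun 1 (weightedMeasure μ ω) :=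
  Lp.memLp f.toLp

/-- The class in `L¹(G, ω)` of an integrable function. -/
noncomputable def mk (g : G → ℂ) (hg : MemLp g 1 (weightedMeasure μ ω)) : BeurlingAlgebra μ ω :=
  hg.toLp g

lemma toFun_mk (g : G → ℂ) (hg : MemLp g 1 (weightedMeasure μ ω)) :
    (mk g hg).toFun =ᵐ[weightedMeasure μ ω] g :=
  hg.coeFn_toLp

lemma ext_ae {f g : BeurlingAlgebra μ ω} (h : f.toFun =ᵐ[weightedMeasure μ ω] g.toFun) : f = g :=
  Lp.ext (f := f.toLp) (g := g.toLp) h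

lemma toFun_add (f g : BeurlingAlgebra μ ω) :
    (f + g).toFun =ᵐ[weightedMeasure μ ω] f.toFun + g.toFun :=
  Lp.coeFn_add f.toLp g.toLp

lemma toFun_smul (c : ℂ) (f : BeurlingAlgebra μ ω) :
    (c • f).toFun =ᵐ[weightedMeasure μ ω] c • f.toFun :=
  Lp.coeFn_smul c f.toLp

lemma toFun_zero : (0 : BeurlingAlgebra μ ω).toFun =ᵐ[weightedMeasure μ ω] 0 :=
  Lp.coeFn_zero ℂ 1 (weightedMeasure μ ω)

lemma enorm_eq_lintegral (f : BeurlingAlgebra μ ω) :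
    ‖f‖ₑ = ∫⁻ x, ‖f.toFun x‖ₑ ∂weightedMeasure μ ω := by
  rw [← eLpNorm_one_eq_lintegral_enorm]
  exact Lp.enorm_def f.toLp

lemma mul_eq_mk [Group G] {f g : BeurlingAlgebra μ ω}
    (h : MemLp (groupConv μ f.toFun g.toFun) 1 (weightedMeasure μ ω)) :
    f * g = mk (groupConv μ f.toFun g.toFun) h :=
  dif_pos h

instance : CompleteSpace (BeurlingAlgebra μ ω) :=
  inferInstanceAs (CompleteSpace (Lp ℂ 1 (weightedMeasure μ ω)))

end BeurlingAlgebra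

/-! ### Coset integration as a bounded map on L¹(G, ω). -/

section CosetMap

variable {G : Type*} [Group G] [TopologicalSpace G] [IsTopologicalGroup G]
  [LocallyCompactSpace G] [T2Space G] [MeasurableSpace G] [BorelSpace G]
  {H : Subgroup G} [H.Normal] {hH : IsClosed (H : Set G)}
  [MeasurableSpace (G ⧸ H)] [BorelSpace (G ⧸ H)]
  {μ : Measure G} [μ.IsHaarMeasure] [μ.Regular]
  {ν : Measure H} [ν.IsHaarMeasure] [ν.Regular]
  {lam : Measure (G ⧸ H)} [lam.IsHaarMeasure] [lam.Regular] [T2Space (G ⧸ H)]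
  {ω : G → ℝ}

lemma quotientWeight_pos {δ : ℝ} (hδ0 : 0 < δ) (hδ : ∀ x, δ ≤ ω x) (q : G ⧸ H) :
    0 < quotientWeight H ω q :=
  hδ0.trans_le (le_quotientWeight hδ q)

lemma measurable_quotientWeight (hω : IsWeight ω) : Measurable (quotientWeight H ω) :=
  (upperSemicontinuous_quotientWeight hω.continuous hω.pos).measurable

/-- The sum of the T|uᵢ| is integrable for the weight ω̂, hence finite almost everywhere, which is
absolute convergence on the corresponding slices. That the slice series sums to f comes from
`ae_slice_of_ae`. -/
lemma IsL1Series.isL1Series_slice (hω : IsWeight ω) {δ : ℝ} (hδ0 : 0 < δ) (hδ : ∀ x, δ ≤ ω x)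
    {k : ℝ} (hk0 : 0 < k)
    (hk : ∀ f : C_c(G, ℝ), ∫ q, cosetPushforward hH ν f q ∂lam = k * ∫ x, f x ∂μ)
    {ι : Type*} [Countable ι] {u : ι → C_c(G, ℂ)} {f : G → ℂ}
    (hs : IsL1Series (weightedMeasure μ ω) (fun i => u i) f) :
    ∀ᵐ q ∂lam, ∀ x : G, (x : G ⧸ H) = q →
      IsL1Series ν (fun i h => u i (x * h)) (fun h => f (x * h)) := by
  have h1 : ∑' i, ∫⁻ q, ENNReal.ofReal (cosetPushforward hH ν (u i).absC q)
      ∂weightedMeasure lam (quotientWeight H ω) ≠ ⊤ := by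
    refine ne_top_of_le_ne_top ?_ (ENNReal.tsum_le_tsum fun i =>
      lintegral_enorm_cosetPushforward_le hω hk0 hk (u i))
    rw [ENNReal.tsum_mul_left]
    exact ENNReal.mul_ne_top (by simp) hs.tsum_ne_top
  have hm : ∀ i, AEMeasurable (fun q => ENNReal.ofReal (cosetPushforward hH ν (u i).absC q))
      (weightedMeasure lam (quotientWeight H ω)) := fun i =>
    (cosetPushforward hH ν (u i).absC).continuous.measurable.ennreal_ofReal.aemeasurable
  rw [← lintegral_tsum hm] at h1
  have h2 := (ae_weightedMeasure_iff (measurable_quotientWeight hω)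
    (quotientWeight_pos hδ0 hδ)).1 (ae_lt_top' (AEMeasurable.tsum hm) h1)
  have h3 := ae_slice_of_ae (ν := ν) (lam := lam) hH
    ((ae_weightedMeasure_iff hω.continuous.measurable hω.pos).1 hs.ae_hasSum)
  filter_upwards [h2, h3] with q hq2 hq3 x hx
  refine ⟨fun i => (integrable_slice hH (u i) x).aestronglyMeasurable, ?_, hq3 x hx⟩
  subst hx
  refine ne_of_eq_of_ne (tsum_congr fun i => ?_) hq2.ne
  rw [cosetPushforward_mk, ofReal_integral_eq_lintegral_ofReal (integrable_slice hH _ x)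
    (Eventually.of_forall fun h => (u i).absC_nonneg _)]
  simp only [CompactlySupportedContinuousMap.absC_apply, ofReal_norm]

lemma IsL1Series.cosetIntegral (hω : IsWeight ω) {δ : ℝ} (hδ0 : 0 < δ) (hδ : ∀ x, δ ≤ ω x)
    {k : ℝ} (hk0 : 0 < k)
    (hk : ∀ f : C_c(G, ℝ), ∫ q, cosetPushforward hH ν f q ∂lam = k * ∫ x, f x ∂μ)
    {ι : Type*} [Countable ι] {u : ι → C_c(G, ℂ)} {f : G → ℂ}
    (hs : IsL1Series (weightedMeasure μ ω) (fun i => u i) f) :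
    IsL1Series (weightedMeasure lam (quotientWeight H ω))
      (fun i => cosetPushforward hH ν (u i)) (cosetIntegral H ν f) ∧
    ∑' i, ∫⁻ q, ‖cosetPushforward hH ν (u i) q‖ₑ ∂weightedMeasure lam (quotientWeight H ω) ≤
      ENNReal.ofReal k * ∑' i, ∫⁻ x, ‖u i x‖ₑ ∂weightedMeasure μ ω := by
  have hle : ∑' i, ∫⁻ q, ‖cosetPushforward hH ν (u i) q‖ₑ
        ∂weightedMeasure lam (quotientWeight H ω) ≤
      ENNReal.ofReal k * ∑' i, ∫⁻ x, ‖u i x‖ₑ ∂weightedMeasure μ ω := by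
    rw [← ENNReal.tsum_mul_left]
    refine ENNReal.tsum_le_tsum fun i => le_trans (lintegral_mono fun q => ?_)
      (lintegral_enorm_cosetPushforward_le hω hk0 hk (u i))
    rw [← ofReal_norm]
    exact ENNReal.ofReal_le_ofReal (norm_cosetPushforward_le (u i) q)
  refine ⟨⟨fun i => ?_, ?_, ?_⟩, hle⟩
  · exact ((cosetPushforward hH ν (u i)).continuous.stronglyMeasurable_of_hasCompactSupport
      (cosetPushforward hH ν (u i)).hasCompactSupport).aestronglyMeasurable
  · exact ne_top_of_le_ne_top (ENNReal.mul_ne_top (by simp) hs.tsum_ne_top) hle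
  · rw [ae_weightedMeasure_iff (measurable_quotientWeight hω) (quotientWeight_pos hδ0 hδ)]
    filter_upwards [hs.isL1Series_slice (hH := hH) (ν := ν) (lam := lam) hω hδ0 hδ hk0 hk]
      with q hq
    induction q using QuotientGroup.induction_on with
    | H x =>
      simp only [cosetPushforward_mk]
      exact (hq x rfl).hasSum_integral

/-- The constant 4 is 1 + 3, from the tolerance ε = ‖f‖; a tolerance must be nonzero, hence the
separate case f = 0. -/
lemma exists_isL1Series_of_beurlingAlgebra {X : Type*} [TopologicalSpace X] [T2Space X]
    [LocallyCompactSpace X] [MeasurableSpace X] [BorelSpace X] {m : Measure X} [m.Regular]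
    {w : X → ℝ} (husc : UpperSemicontinuous w) {δ : ℝ} (hδ0 : 0 < δ) (hδ : ∀ x, δ ≤ w x)
    (f : BeurlingAlgebra m w) :
    ∃ u : ℕ → C_c(X, ℂ), IsL1Series (weightedMeasure m w) (fun n => u n) f.toFun ∧
      (f ≠ 0 → ∑' n, ∫⁻ x, ‖u n x‖ₑ ∂weightedMeasure m w ≤ 4 * ‖f‖ₑ) := by
  have := regular_weightedMeasure (m := m) husc hδ0 hδ
  by_cases hf : f = 0
  · obtain ⟨u, hu, -⟩ := f.memLp_toFun.exists_isL1Series_compactlySupported one_ne_zero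
      ENNReal.one_ne_top
    exact ⟨u, hu, fun h => absurd hf h⟩
  · obtain ⟨u, hu, hle⟩ := f.memLp_toFun.exists_isL1Series_compactlySupported (ε := ‖f‖ₑ)
      (by simpa using hf) enorm_ne_top
    refine ⟨u, hu, fun _ => hle.trans (le_of_eq ?_)⟩
    rw [← f.enorm_eq_lintegral]
    ring

/-- Integration over the cosets of `H` defines a continuous linear map from `L¹(G, ω)` to
`L¹(G ⧸ H, ω̂)`. -/
lemma exists_cosetMap (hH : IsClosed (H : Set G)) (hω : IsWeight ω) {δ : ℝ} (hδ0 : 0 < δ)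
    (hδ : ∀ x, δ ≤ ω x) :
    ∃ T : BeurlingAlgebra μ ω →L[ℂ] BeurlingAlgebra lam (quotientWeight H ω),
      ∀ f, (T f).toFun =ᵐ[lam] cosetIntegral H ν f.toFun := by
  obtain ⟨k, hk0, hk, -⟩ := exists_integral_cosetPushforward_eq hH μ ν lam
  have hw := measurable_quotientWeight (H := H) hω
  have hwpos := quotientWeight_pos (H := H) hδ0 hδ
  have husc : UpperSemicontinuous ω := hω.continuous.upperSemicontinuous
  have hmem : ∀ f : BeurlingAlgebra μ ω, MemLp (cosetIntegral H ν f.toFun) 1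
      (weightedMeasure lam (quotientWeight H ω)) := fun f => by
    obtain ⟨u, hu, -⟩ := exists_isL1Series_of_beurlingAlgebra husc hδ0 hδ f
    exact (hu.cosetIntegral hω hδ0 hδ hk0 hk).1.memLp
  have hslice : ∀ {p : G → Prop}, (∀ᵐ x ∂weightedMeasure μ ω, p x) →
      ∀ᵐ q ∂weightedMeasure lam (quotientWeight H ω), ∀ x : G, (x : G ⧸ H) = q →
        ∀ᵐ h : H ∂ν, p (x * h) := fun hp => by
    rw [ae_weightedMeasure_iff hw hwpos]
    exact ae_slice_of_ae hH ((ae_weightedMeasure_iff hω.continuous.measurable hω.pos).1 hp)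
  have hint : ∀ f : BeurlingAlgebra μ ω, ∀ᵐ q ∂weightedMeasure lam (quotientWeight H ω),
      ∀ x : G, (x : G ⧸ H) = q → Integrable (fun h : H => f.toFun (x * h)) ν := fun f => by
    obtain ⟨u, hu, -⟩ := exists_isL1Series_of_beurlingAlgebra husc hδ0 hδ f
    rw [ae_weightedMeasure_iff hw hwpos]
    filter_upwards [hu.isL1Series_slice (hH := hH) (ν := ν) (lam := lam) hω hδ0 hδ hk0 hk]
      with q hq x hx
    exact memLp_one_iff_integrable.1 (hq x hx).memLp
  let T₀ : BeurlingAlgebra μ ω →ₗ[ℂ] BeurlingAlgebra lam (quotientWeight H ω) :=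
    { toFun := fun f => BeurlingAlgebra.mk _ (hmem f)
      map_add' := fun f g => by
        refine BeurlingAlgebra.ext_ae ?_
        filter_upwards [BeurlingAlgebra.toFun_mk _ (hmem (f + g)),
          BeurlingAlgebra.toFun_mk _ (hmem f), BeurlingAlgebra.toFun_mk _ (hmem g),
          BeurlingAlgebra.toFun_add (BeurlingAlgebra.mk _ (hmem f))
            (BeurlingAlgebra.mk _ (hmem g)),
          hslice (BeurlingAlgebra.toFun_add f g), hint f, hint g] with q h1 h2 h3 h4 h5 h6 h7
        rw [h1, h4, Pi.add_apply, h2, h3]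
        induction q using QuotientGroup.induction_on with
        | H x =>
          simp only [cosetIntegral_mk]
          rw [← integral_add (h6 x rfl) (h7 x rfl)]
          exact integral_congr_ae (h5 x rfl)
      map_smul' := fun c f => by
        refine BeurlingAlgebra.ext_ae ?_
        filter_upwards [BeurlingAlgebra.toFun_mk _ (hmem (c • f)),
          BeurlingAlgebra.toFun_mk _ (hmem f),
          BeurlingAlgebra.toFun_smul c (BeurlingAlgebra.mk _ (hmem f)),
          hslice (BeurlingAlgebra.toFun_smul c f)] with q h1 h2 h4 h5
        rw [h1, RingHom.id_apply, h4, Pi.smul_apply, h2]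
        induction q using QuotientGroup.induction_on with
        | H x =>
          simp only [cosetIntegral_mk]
          rw [← integral_smul]
          exact integral_congr_ae (h5 x rfl) }
  have hbound : ∀ f, ‖T₀ f‖ ≤ (k * 4) * ‖f‖ := by
    intro f
    by_cases hf : f = 0
    · simp [hf]
    obtain ⟨u, hu, hle⟩ := exists_isL1Series_of_beurlingAlgebra husc hδ0 hδ f
    obtain ⟨hs, hle2⟩ := hu.cosetIntegral (hH := hH) (ν := ν) (lam := lam) hω hδ0 hδ hk0 hk
    have h1 : ‖T₀ f‖ₑ ≤ ENNReal.ofReal k * (4 * ‖f‖ₑ) := by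
      have h0 : (T₀ f).toFun =ᵐ[weightedMeasure lam (quotientWeight H ω)] _ :=
        BeurlingAlgebra.toFun_mk _ (hmem f)
      rw [BeurlingAlgebra.enorm_eq_lintegral,
        lintegral_congr_ae (h0.mono fun q hq => congrArg enorm hq)]
      refine hs.lintegral_enorm_le.trans (hle2.trans ?_)
      gcongr
      exact hle hf
    rw [← ofReal_norm, ← ofReal_norm, show (4 : ℝ≥0∞) = ENNReal.ofReal 4 by simp,
      ← ENNReal.ofReal_mul (by norm_num), ← ENNReal.ofReal_mul hk0.le, ← mul_assoc] at h1
    exact (ENNReal.ofReal_le_ofReal_iff (by positivity)).1 h1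
  refine ⟨T₀.mkContinuous _ hbound, fun f => ?_⟩
  have h1 : (T₀ f).toFun =ᵐ[weightedMeasure lam (quotientWeight H ω)] _ :=
    BeurlingAlgebra.toFun_mk _ (hmem f)
  exact (ae_weightedMeasure_iff hw hwpos).1 h1

end CosetMap

/-! ### Transfer of weak amenability. -/

/-- Weak amenability passes along a surjective map `T` which is multiplicative up to a constant,
if the kernel of `T` has a complement that is closed under commutators up to elements of the closed
span of the commutators with the kernel. -/
lemma WeaklyAmenable.of_surjective {A B : Type*} [NormedAddCommGroup A] [NormedSpace ℂ A]
    [CompleteSpace A] [Mul A] [NormedAddCommGroup B] [NormedSpace ℂ B] [CompleteSpace B] [Mul B]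
    (T : A →L[ℂ] B) (hT : Function.Surjective T) {k : ℂ} (hk : k ≠ 0)
    (hmul : ∀ a b, T a * T b = k • T (a * b)) (h0mul : ∀ b : B, 0 * b = 0)
    (hmul0 : ∀ b : B, b * 0 = 0) {J : Set A} (hJ : ∀ a, a ∈ J ↔ T a = 0) (X : Submodule ℂ A)
    (hX : IsBanachComplement J X)
    (hcomm : ∀ x ∈ X, ∀ y ∈ X, x * y - y * x ∈ commutatorClosure J ⊔ X)
    (hA : WeaklyAmenable A) : WeaklyAmenable B := by
  intro D hD
  obtain ⟨hXc, hXu⟩ := hX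
  have : CompleteSpace X := hXc.completeSpace_coe
  let TX : X →L[ℂ] B := T.comp X.subtypeL
  have hTXs : Function.Surjective TX := by
    intro b
    obtain ⟨a, rfl⟩ := hT b
    obtain ⟨⟨j, x⟩, ⟨hj, hx, rfl⟩, -⟩ := hXu a
    exact ⟨⟨x, hx⟩, by simp [TX, (hJ j).1 hj]⟩
  have hTXi : Function.Injective TX := by
    rw [injective_iff_map_eq_zero]
    rintro ⟨x, hx⟩ h
    have hxJ : x ∈ J := (hJ x).2 h
    have h1 := (hXu x).unique (y₁ := (x, 0)) (y₂ := (0, x)) ⟨hxJ, X.zero_mem, by simp⟩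
      ⟨(hJ 0).2 (map_zero T), hx, by simp⟩
    exact Subtype.ext (congrArg Prod.fst h1)
  -- The inverse is continuous by the open mapping theorem, X being complete as a closed subspace.
  let e : X ≃L[ℂ] B := ContinuousLinearEquiv.ofBijective TX
    (LinearMap.ker_eq_bot.2 hTXi) (LinearMap.range_eq_top.2 hTXs)
  have he : ∀ x : X, e x = T x := fun x => rfl
  let D' : A →L[ℂ] (A →L[ℂ] ℂ) := ((ContinuousLinearMap.compL ℂ A B ℂ).flip T).comp (D.comp T)
  have hD' : ∀ a c, D' a c = D (T a) (T c) := fun a c => rfl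
  have hTmul : ∀ a b, T (a * b) = k⁻¹ • (T a * T b) := fun a b => by
    rw [hmul, inv_smul_smul₀ hk]
  -- Each term of the derivation identity contains exactly one product transported by T, so the
  -- factors k⁻¹ agree on both sides.
  obtain ⟨φ, hφ⟩ := hA D' fun a b c => by
    simp only [hD', hTmul, map_smul, smul_apply, hD, smul_add]
  have hφJ : ∀ a ∈ commutatorClosure J, φ a = 0 := by
    have h1 : commutatorClosure J ≤ LinearMap.ker (φ : A →ₗ[ℂ] ℂ) := by
      refine Submodule.topologicalClosure_minimal _ (Submodule.span_le.2 ?_) φ.isClosed_ker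
      rintro _ ⟨f, j, hj, rfl⟩
      -- Since Tj = 0, the functional D' j is zero, and its value at f is φ(fj - jf).
      have h2 := hφ j f
      rw [hD', (hJ j).1 hj, map_zero, zero_apply, ← map_sub] at h2
      exact h2.symm
    exact fun a ha => h1 ha
  have hTJ : ∀ a ∈ commutatorClosure J, T a = 0 := by
    have h1 : commutatorClosure J ≤ LinearMap.ker (T : A →ₗ[ℂ] B) := by
      refine Submodule.topologicalClosure_minimal _ (Submodule.span_le.2 ?_) T.isClosed_ker
      rintro _ ⟨f, j, hj, rfl⟩
      change T (f * j - j * f) = 0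
      rw [map_sub, hTmul, hTmul, (hJ j).1 hj, h0mul, hmul0, sub_self]
    exact fun a ha => h1 ha
  -- The factor k⁻¹ cancels the k in TyTx - TxTy = k T(yx - xy).
  refine ⟨k⁻¹ • φ.comp (X.subtypeL.comp (e.symm : B →L[ℂ] X)), fun b d => ?_⟩
  obtain ⟨⟨x, hx⟩, rfl⟩ := hTXs b
  obtain ⟨⟨y, hy⟩, rfl⟩ := hTXs d
  change D (T x) (T y) = _
  rw [← hD', hφ, ← map_sub, ← map_sub]
  obtain ⟨j, hj, z, hz, hjz⟩ := Submodule.mem_sup.1 (hcomm y hy x hx)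
  have h3 : T y * T x - T x * T y = k • e ⟨z, hz⟩ := by
    rw [he, hmul, hmul, ← smul_sub, ← map_sub, ← hjz, map_add, hTJ j hj, zero_add]
  change _ = (k⁻¹ • φ.comp (X.subtypeL.comp (e.symm : B →L[ℂ] X))) (T y * T x - T x * T y)
  rw [h3, ← hjz, map_add, hφJ j hj, zero_add]
  simp [hk]

/-! ### Multiplicativity of T up to the constant k. -/

section CosetMap

variable {G : Type*} [Group G] [TopologicalSpace G] [IsTopologicalGroup G]
  [LocallyCompactSpace G] [T2Space G] [MeasurableSpace G] [BorelSpace G]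
  {H : Subgroup G} [H.Normal]
  [MeasurableSpace (G ⧸ H)] [BorelSpace (G ⧸ H)]
  {μ : Measure G} [μ.IsHaarMeasure] [μ.Regular]
  {ν : Measure H} [ν.IsHaarMeasure] [ν.Regular]
  {lam : Measure (G ⧸ H)} [lam.IsHaarMeasure] [lam.Regular] [T2Space (G ⧸ H)]
  {ω : G → ℝ}

/-- Expand f and g in series of C_c functions. Both sides become sums of double series whose terms
agree by `smul_cosetPushforward_conv`, so they agree almost everywhere by uniqueness of sums. -/
lemma toFun_mul_cosetMap [LocallyCompactSpace (G ⧸ H)] (hH : IsClosed (H : Set G))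
    (hω : IsWeight ω) {δ : ℝ} (hδ0 : 0 < δ) (hδ : ∀ x, δ ≤ ω x) {k : ℝ} (hk0 : 0 < k)
    (hkR : ∀ f : C_c(G, ℝ), ∫ q, cosetPushforward hH ν f q ∂lam = k * ∫ x, f x ∂μ)
    (hkC : ∀ f : C_c(G, ℂ), ∫ q, cosetPushforward hH ν f q ∂lam = k * ∫ x, f x ∂μ)
    {T : BeurlingAlgebra μ ω →L[ℂ] BeurlingAlgebra lam (quotientWeight H ω)}
    (hT : ∀ f, (T f).toFun =ᵐ[lam] cosetIntegral H ν f.toFun) (f g : BeurlingAlgebra μ ω) :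
    T f * T g = (k : ℂ) • T (f * g) := by
  have husc : UpperSemicontinuous ω := hω.continuous.upperSemicontinuous
  have hw := measurable_quotientWeight (H := H) hω
  have hwpos := quotientWeight_pos (H := H) hδ0 hδ
  obtain ⟨u, hu, -⟩ := exists_isL1Series_of_beurlingAlgebra husc hδ0 hδ f
  obtain ⟨v, hv, -⟩ := exists_isL1Series_of_beurlingAlgebra husc hδ0 hδ g
  have hsum : ∑' i : ℕ × ℕ, ∫⁻ x, absConv μ (u i.1) (v i.2) x ∂weightedMeasure μ ω ≠ ⊤ := by
    refine ne_top_of_le_ne_top ?_ (ENNReal.tsum_le_tsum fun i : ℕ × ℕ =>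
      lintegral_absConv_le hω (u i.1) (v i.2))
    rw [ENNReal.tsum_prod (f := fun i j => (∫⁻ x, ‖u i x‖ₑ ∂weightedMeasure μ ω) *
      ∫⁻ x, ‖v j x‖ₑ ∂weightedMeasure μ ω)]
    simp only [ENNReal.tsum_mul_left, ENNReal.tsum_mul_right]
    exact ENNReal.mul_ne_top hu.tsum_ne_top hv.tsum_ne_top
  have hfg := isL1Series_groupConv
    ((ae_weightedMeasure_iff hω.continuous.measurable hω.pos).1 hu.ae_hasSum)
    ((ae_weightedMeasure_iff hω.continuous.measurable hω.pos).1 hv.ae_hasSum)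
    (fun i j => (measurable_absConv (u i) (v j)).aemeasurable) hsum
  have hsum' : ∑' i : ℕ × ℕ, ∫⁻ q, absConv lam (cosetPushforward hH ν (u i.1))
      (cosetPushforward hH ν (v i.2)) q ∂weightedMeasure lam (quotientWeight H ω) ≠ ⊤ := by
    refine ne_top_of_le_ne_top ?_ (ENNReal.tsum_le_tsum fun i : ℕ × ℕ =>
      lintegral_absConv_cosetPushforward_le hω hk0 hkR (u i.1) (v i.2))
    rw [ENNReal.tsum_mul_left, ENNReal.tsum_mul_left]
    exact ENNReal.mul_ne_top (by simp) (ENNReal.mul_ne_top (by simp) hsum)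
  have hTfg := isL1Series_groupConv
    ((ae_weightedMeasure_iff hw hwpos).1
      (hu.cosetIntegral (hH := hH) (ν := ν) (lam := lam) hω hδ0 hδ hk0 hkR).1.ae_hasSum)
    ((ae_weightedMeasure_iff hw hwpos).1
      (hv.cosetIntegral (hH := hH) (ν := ν) (lam := lam) hω hδ0 hδ hk0 hkR).1.ae_hasSum)
    (fun i j => (measurable_absConv (cosetPushforward hH ν (u i))
      (cosetPushforward hH ν (v j))).aemeasurable) hsum'
  rw [← groupConv_congr_ae (hT f) (hT g)] at hTfg
  have hfg' : IsL1Series (weightedMeasure μ ω)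
      (fun i : ℕ × ℕ => ((u i.1).conv μ (v i.2) : C_c(G, ℂ))) (f * g).toFun := by
    refine ⟨hfg.aestronglyMeasurable, hfg.tsum_ne_top, ?_⟩
    rw [BeurlingAlgebra.mul_eq_mk hfg.memLp]
    filter_upwards [hfg.ae_hasSum, BeurlingAlgebra.toFun_mk _ hfg.memLp] with x hx1 hx2
    rw [hx2]
    exact hx1
  have hTm := (hfg'.cosetIntegral (hH := hH) (ν := ν) (lam := lam) hω hδ0 hδ hk0 hkR).1
  refine BeurlingAlgebra.ext_ae ?_
  rw [BeurlingAlgebra.mul_eq_mk hTfg.memLp]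
  filter_upwards [BeurlingAlgebra.toFun_mk _ hTfg.memLp, hTfg.ae_hasSum, hTm.ae_hasSum,
    BeurlingAlgebra.toFun_smul (k : ℂ) (T (f * g)),
    (ae_weightedMeasure_iff hw hwpos).2 (hT (f * g))] with q h1 h2 h3 h4 h5
  rw [h1, h4, Pi.smul_apply, h5]
  have h6 : ∀ i : ℕ × ℕ, groupConv lam (cosetPushforward hH ν (u i.1))
      (cosetPushforward hH ν (v i.2)) q =
        (k : ℂ) • cosetPushforward hH ν ((u i.1).conv μ (v i.2)) q := fun i =>
    (smul_cosetPushforward_conv (fun f => (hkC f).trans (Complex.real_smul ..).symm)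
      (u i.1) (v i.2) q).symm.trans Complex.real_smul
  simp only [h6] at h2
  exact h2.unique (h3.const_smul (k : ℂ))

end CosetMap

/-! ### Surjectivity of T. -/

section Surjective

variable {G : Type*} [Group G] [TopologicalSpace G] [IsTopologicalGroup G]
  [LocallyCompactSpace G] [T2Space G] [MeasurableSpace G] [BorelSpace G]
  {H : Subgroup G} [H.Normal]
  [MeasurableSpace (G ⧸ H)] [BorelSpace (G ⧸ H)]
  {μ : Measure G} [μ.IsHaarMeasure] [μ.Regular]
  {ν : Measure H} [ν.IsHaarMeasure] [ν.Regular]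
  {lam : Measure (G ⧸ H)} [lam.IsHaarMeasure] [lam.Regular] [T2Space (G ⧸ H)]
  {ω : G → ℝ}

/-- Choose x in the coset with ω(x) < 2 ω̂([x]). For y near x, ω(y) is still below 2 ω̂([x]), and
ω̂([x]) ≤ ω(xy⁻¹) ω̂([y]) with ω(xy⁻¹) < ω(1) + 1. So ω is comparable to ω̂ near a suitable
representative of every coset. -/
lemma exists_mk_eq_eventually_lt_quotientWeight (hω : IsWeight ω) {δ : ℝ} (hδ0 : 0 < δ)
    (hδ : ∀ x, δ ≤ ω x) (q : G ⧸ H) :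
    ∃ x : G, (x : G ⧸ H) = q ∧ ∀ᶠ y in 𝓝 x, ω y < 2 * (ω 1 + 1) * quotientWeight H ω y := by
  have hpos := quotientWeight_pos (H := H) hδ0 hδ q
  obtain ⟨x, rfl, hx⟩ := exists_lt_of_quotientWeight_lt
    (show quotientWeight H ω q < 2 * quotientWeight H ω q by linarith)
  refine ⟨x, rfl, ?_⟩
  have h1 : ∀ᶠ y in 𝓝 x, ω y < 2 * quotientWeight H ω x :=
    hω.continuous.continuousAt.eventually_lt continuousAt_const hx
  have hc : Continuous fun y => ω (x * y⁻¹) := hω.continuous.comp (by fun_prop)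
  have h2 : ∀ᶠ y in 𝓝 x, ω (x * y⁻¹) < ω 1 + 1 :=
    hc.continuousAt.eventually_lt continuousAt_const (by simp)
  filter_upwards [h1, h2] with y hy1 hy2
  have h3 := quotientWeight_mul_le (H := H) hω.pos hω.submul (x * y⁻¹) y
  rw [← QuotientGroup.mk_mul, inv_mul_cancel_right] at h3
  have h4 := quotientWeight_pos (H := H) hδ0 hδ y
  nlinarith [mul_lt_mul_of_pos_right hy2 h4]

lemma exists_isCompact_subset_image_mk {W : Set G}
    (hW : ∀ q : G ⧸ H, ∃ x : G, (x : G ⧸ H) = q ∧ W ∈ 𝓝 x) {S : Set (G ⧸ H)} (hS : IsCompact S) :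
    ∃ K ⊆ W, IsCompact K ∧ S ⊆ ((↑) : G → G ⧸ H) '' K := by
  refine hS.induction_on (p := fun S => ∃ K ⊆ W, IsCompact K ∧ S ⊆ ((↑) : G → G ⧸ H) '' K)
    ⟨∅, by simp⟩ ?_ ?_ ?_
  · rintro s t hst ⟨K, hKW, hK, htK⟩
    exact ⟨K, hKW, hK, hst.trans htK⟩
  · rintro s t ⟨K, hKW, hK, hsK⟩ ⟨L, hLW, hL, htL⟩
    refine ⟨K ∪ L, Set.union_subset hKW hLW, hK.union hL, ?_⟩
    rw [Set.image_union]
    exact Set.union_subset_union hsK htL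
  · intro q _
    obtain ⟨x, rfl, hx⟩ := hW q
    obtain ⟨K, hKx, hKW, hK⟩ := local_compact_nhds hx
    exact ⟨_, mem_nhdsWithin_of_mem_nhds ((QuotientGroup.isOpenMap_coe).image_mem_nhds hKx),
      K, hKW, hK, subset_rfl⟩

/-- Compactly supported continuous functions on the quotient lift to compactly supported continuous
functions on the group, with control on the weighted norm. -/
lemma exists_cosetPushforward_eq (hH : IsClosed (H : Set G)) (hω : IsWeight ω) {δ : ℝ}
    (hδ0 : 0 < δ) (hδ : ∀ x, δ ≤ ω x) {k : ℝ} (hk0 : 0 < k)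
    (hk : ∀ f : C_c(G, ℝ), ∫ q, cosetPushforward hH ν f q ∂lam = k * ∫ x, f x ∂μ)
    (g : C_c(G ⧸ H, ℂ)) :
    ∃ f : C_c(G, ℂ), cosetPushforward hH ν f = g ∧
      ∫⁻ x, ‖f x‖ₑ ∂weightedMeasure μ ω ≤ ENNReal.ofReal (k⁻¹ * (2 * (ω 1 + 1))) *
        ∫⁻ q, ‖g q‖ₑ ∂weightedMeasure lam (quotientWeight H ω) := by
  set C := 2 * (ω 1 + 1)
  have hC : 0 < C := by have := hω.pos 1; positivity
  let W := {x : G | ω x < C * quotientWeight H ω x}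
  obtain ⟨K, hKW, hK, hgK⟩ := exists_isCompact_subset_image_mk (W := interior W)
    (fun q => by
      obtain ⟨x, hx, hxW⟩ := exists_mk_eq_eventually_lt_quotientWeight hω hδ0 hδ q
      exact ⟨x, hx, interior_mem_nhds.2 hxW⟩) g.hasCompactSupport.isCompact
  obtain ⟨φ, hφ1, hφ0, hφc, hφ⟩ := exists_continuous_one_zero_of_isCompact hK
    isOpen_interior.isClosed_compl (Set.disjoint_compl_right_iff_subset.2 hKW)
  let Φ : C_c(G, ℝ) := ⟨φ, hφc⟩
  have hΦ : ∀ x, Φ x = φ x := fun x => rfl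
  have hΦ0 : ∀ x, 0 ≤ Φ x := fun x => (hφ x).1
  have hTpos : ∀ q ∈ tsupport g, 0 < cosetPushforward hH ν Φ q := by
    intro q hq
    obtain ⟨x, hx, rfl⟩ := hgK hq
    rw [cosetPushforward_mk]
    obtain ⟨h1, h2⟩ := continuous_isCompact_slice hH Φ x
    refine h1.integral_pos_of_hasCompactSupport_nonneg_nonzero h2 (fun h => (hφ _).1) (x := 1) ?_
    simp [hΦ, hφ1 hx]
  -- The lift is Φ times the pullback of r. Since r is constant on cosets, T multiplies r by TΦ and
  -- returns g; the denominator is positive on the support of g.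
  let r : G ⧸ H → ℂ := fun q => g q / (cosetPushforward hH ν Φ q : ℝ)
  have hr0 : ∀ q ∉ tsupport g, r q = 0 := fun q hq => by
    simp [r, image_eq_zero_of_notMem_tsupport hq]
  have hrc : Continuous r := by
    refine continuous_of_tsupport fun q hq => ?_
    have hq' : q ∈ tsupport g := closure_mono
      (Function.support_subset_iff'.2 fun p hp => by simp [r, Function.notMem_support.1 hp]) hq
    refine g.continuous.continuousAt.div (Complex.continuous_ofReal.comp
      (cosetPushforward hH ν Φ).continuous).continuousAt ?_
    exact_mod_cast (hTpos q hq').ne'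
  have hTr : ∀ q, (cosetPushforward hH ν Φ q : ℂ) * r q = g q := fun q => by
    by_cases hq : q ∈ tsupport g
    · have : (cosetPushforward hH ν Φ q : ℂ) ≠ 0 := by exact_mod_cast (hTpos q hq).ne'
      exact mul_div_cancel₀ _ this
    · rw [hr0 q hq, mul_zero, image_eq_zero_of_notMem_tsupport hq]
  have hmk := QuotientGroup.continuous_mk (N := H)
  let f : C_c(G, ℂ) := ⟨⟨fun x => (Φ x : ℂ) * r x,
    (Complex.continuous_ofReal.comp Φ.continuous).mul (hrc.comp hmk)⟩,
    (Φ.hasCompactSupport.comp_left Complex.ofReal_zero).mul_right⟩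
  have hf : ∀ x, f x = (Φ x : ℂ) * r x := fun x => rfl
  have hfn : ∀ x, f.absC x = Φ x * ‖r x‖ := fun x => by
    rw [CompactlySupportedContinuousMap.absC_apply, hf, norm_mul, Complex.norm_real,
      Real.norm_of_nonneg (hΦ0 x)]
  have hTabs : ∀ q, cosetPushforward hH ν f.absC q = ‖g q‖ := fun q => by
    rw [← hTr q, norm_mul, Complex.norm_real,
      Real.norm_of_nonneg (cosetPushforward_nonneg hΦ0 q)]
    induction q using QuotientGroup.induction_on with
    | H x =>
      simp only [cosetPushforward_mk, hfn, QuotientGroup.mk_mul_of_mem x (SetLike.coe_mem _)]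
      rw [integral_mul_const]
  refine ⟨f, ?_, ?_⟩
  · ext q
    rw [← hTr q]
    induction q using QuotientGroup.induction_on with
    | H x =>
      simp only [cosetPushforward_mk, hf, QuotientGroup.mk_mul_of_mem x (SetLike.coe_mem _)]
      rw [integral_mul_const, integral_complex_ofReal]
  · have h1 : ∫⁻ x, ‖f x‖ₑ ∂weightedMeasure μ ω =
        ENNReal.ofReal (∫ x, f.absC.weightMul hω.continuous x ∂μ) := by
      rw [← lintegral_weightedMeasure_ofReal hω.continuous hω.pos f.absC_nonneg]
      simp only [CompactlySupportedContinuousMap.absC_apply, ofReal_norm]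
    have hnn : ∀ x, 0 ≤ f.absC.weightMul hω.continuous x := fun x =>
      mul_nonneg (hω.pos x).le (f.absC_nonneg x)
    -- Φ vanishes off the interior of W, and on W the weight ω is below C ω̂, which is constant
    -- along the coset.
    have h2 : ∀ q, cosetPushforward hH ν (f.absC.weightMul hω.continuous) q ≤
        C * (quotientWeight H ω q * ‖g q‖) := fun q => by
      rw [← hTabs q]
      induction q using QuotientGroup.induction_on with
      | H x =>
        rw [cosetPushforward_mk, cosetPushforward_mk, ← integral_const_mul, ← integral_const_mul]
        refine integral_mono (integrable_slice hH _ x)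
          (((integrable_slice hH _ x).const_mul _).const_mul _) fun h => ?_
        simp only [CompactlySupportedContinuousMap.weightMul_apply]
        rw [← mul_assoc]
        by_cases hxh : x * (h : G) ∈ interior W
        · have h3 : ω (x * h) < C * quotientWeight H ω ((x * h : G) : G ⧸ H) :=
            (interior_subset hxh : x * (h : G) ∈ W)
          rw [QuotientGroup.mk_mul_of_mem x h.2] at h3
          exact mul_le_mul_of_nonneg_right h3.le (f.absC_nonneg _)
        · have h3 : φ (x * h) = 0 := hφ0 hxh
          simp [hfn, hΦ, h3]
    have h3 : ∫ x, f.absC.weightMul hω.continuous x ∂μ =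
        k⁻¹ * ∫ q, cosetPushforward hH ν (f.absC.weightMul hω.continuous) q ∂lam := by
      rw [hk, inv_mul_cancel_left₀ hk0.ne']
    have husc := upperSemicontinuous_quotientWeight (H := H) hω.continuous hω.pos
    rw [h1, h3, ENNReal.ofReal_mul (by positivity), ENNReal.ofReal_mul (by positivity), mul_assoc,
      ofReal_integral_eq_lintegral_ofReal (CompactlySupportedContinuousMap.integrable' _)
        (Eventually.of_forall (cosetPushforward_nonneg hnn)),
      lintegral_weightedMeasure husc.measurable]
    refine mul_le_mul_right ?_ _
    rw [← lintegral_const_mul' (ENNReal.ofReal C) _ (by simp)]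
    refine lintegral_mono fun q => ?_
    rw [← ofReal_norm, ← ENNReal.ofReal_mul (quotientWeight_pos hδ0 hδ q).le,
      ← ENNReal.ofReal_mul hC.le]
    exact ENNReal.ofReal_le_ofReal (h2 q)

/-- Lift the terms of a C_c series for b one by one. The norm bound is uniform over the terms, so
the lifted series converges absolutely in L¹(G, ω), and T maps its sum to b. -/
lemma cosetMap_surjective [LocallyCompactSpace (G ⧸ H)] (hH : IsClosed (H : Set G))
    (hω : IsWeight ω) {δ : ℝ} (hδ0 : 0 < δ) (hδ : ∀ x, δ ≤ ω x) {k : ℝ} (hk0 : 0 < k)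
    (hk : ∀ f : C_c(G, ℝ), ∫ q, cosetPushforward hH ν f q ∂lam = k * ∫ x, f x ∂μ)
    {T : BeurlingAlgebra μ ω →L[ℂ] BeurlingAlgebra lam (quotientWeight H ω)}
    (hT : ∀ f, (T f).toFun =ᵐ[lam] cosetIntegral H ν f.toFun) : Function.Surjective T := by
  intro b
  have hw := measurable_quotientWeight (H := H) hω
  have hwpos := quotientWeight_pos (H := H) hδ0 hδ
  obtain ⟨g, hg, -⟩ := exists_isL1Series_of_beurlingAlgebra
    (upperSemicontinuous_quotientWeight hω.continuous hω.pos) hδ0 (le_quotientWeight hδ) b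
  choose f hfg hf using fun n => exists_cosetPushforward_eq hH hω hδ0 hδ hk0 hk (g n)
  have hne : ∑' n, ∫⁻ x, ‖f n x‖ₑ ∂weightedMeasure μ ω ≠ ⊤ := by
    refine ne_top_of_le_ne_top ?_ (ENNReal.tsum_le_tsum hf)
    rw [ENNReal.tsum_mul_left]
    exact ENNReal.mul_ne_top (by simp) hg.tsum_ne_top
  have hm : ∀ n, AEStronglyMeasurable (f n) (weightedMeasure μ ω) := fun n =>
    ((f n).continuous.stronglyMeasurable_of_hasCompactSupport
      (f n).hasCompactSupport).aestronglyMeasurable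
  have hF : IsL1Series (weightedMeasure μ ω) (fun n => f n) (fun x => ∑' n, f n x) :=
    ⟨hm, hne, (ae_summable_norm_of_tsum_lintegral_ne_top hm hne).mono fun x hx =>
      hx.of_norm.hasSum⟩
  have hF' : IsL1Series (weightedMeasure μ ω) (fun n => f n)
      (BeurlingAlgebra.mk _ hF.memLp : BeurlingAlgebra μ ω).toFun := by
    refine ⟨hm, hne, ?_⟩
    filter_upwards [hF.ae_hasSum, BeurlingAlgebra.toFun_mk _ hF.memLp] with x hx1 hx2
    rwa [hx2]
  refine ⟨BeurlingAlgebra.mk _ hF.memLp, BeurlingAlgebra.ext_ae ?_⟩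
  filter_upwards [(ae_weightedMeasure_iff hw hwpos).2 (hT (BeurlingAlgebra.mk _ hF.memLp)),
    hg.ae_hasSum, (hF'.cosetIntegral (hH := hH) (ν := ν) (lam := lam) hω hδ0 hδ
      hk0 hk).1.ae_hasSum] with q h1 h2 h3
  rw [h1]
  simp only [hfg] at h3
  exact h3.unique h2

end Surjective

/-! ### Products with zero. -/

namespace BeurlingAlgebra

variable {G : Type*} [Group G] [TopologicalSpace G] [IsTopologicalGroup G]
  [LocallyCompactSpace G] [T2Space G] [MeasurableSpace G] [BorelSpace G]
  {μ : Measure G} [μ.IsHaarMeasure] [μ.Regular] {ω : G → ℝ}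

/-- The product is a bare `Mul` instance, so annihilation by zero has to be checked through
representatives before the transfer lemma applies. -/
lemma mul_eq_zero_of_groupConv_eq_zero {f g : BeurlingAlgebra μ ω}
    (h : groupConv μ f.toFun g.toFun = 0) : f * g = 0 := by
  have hm : MemLp (groupConv μ f.toFun g.toFun) 1 (weightedMeasure μ ω) := h ▸ MemLp.zero
  refine ext_ae ?_
  rw [mul_eq_mk hm]
  filter_upwards [toFun_mk _ hm, toFun_zero (μ := μ) (ω := ω)] with x h1 h2
  rw [h1, h2, h]

lemma toFun_zero_ae (hw : Measurable ω) (hpos : ∀ x, 0 < ω x) :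
    (0 : BeurlingAlgebra μ ω).toFun =ᵐ[μ] 0 :=
  (ae_weightedMeasure_iff hw hpos).1 toFun_zero

protected lemma zero_mul (hw : Measurable ω) (hpos : ∀ x, 0 < ω x) (f : BeurlingAlgebra μ ω) :
    0 * f = 0 := by
  refine mul_eq_zero_of_groupConv_eq_zero ?_
  rw [groupConv_congr_ae (toFun_zero_ae hw hpos) (EventuallyEq.refl _ f.toFun)]
  ext x
  simp [groupConv]

protected lemma mul_zero (hw : Measurable ω) (hpos : ∀ x, 0 < ω x) (f : BeurlingAlgebra μ ω) :
    f * 0 = 0 := by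
  refine mul_eq_zero_of_groupConv_eq_zero ?_
  rw [groupConv_congr_ae (EventuallyEq.refl _ f.toFun) (toFun_zero_ae hw hpos)]
  ext x
  simp [groupConv]

end BeurlingAlgebra

/-! ### The main theorem. -/

theorem mainTheorem8 {G : Type*} [Group G] [TopologicalSpace G] [IsTopologicalGroup G]
    [LocallyCompactSpace G] [T2Space G] [MeasurableSpace G] [BorelSpace G]
    (H : Subgroup G) [H.Normal] (hH : IsClosed (H : Set G))
    [MeasurableSpace (G ⧸ H)] [BorelSpace (G ⧸ H)]
    (μ : Measure G) [μ.IsHaarMeasure] [μ.Regular]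
    (ν : Measure H) [ν.IsHaarMeasure] [ν.Regular]
    (lam : Measure (G ⧸ H)) [lam.IsHaarMeasure] [lam.Regular]
    (ω : G → ℝ) (hω : IsWeight ω) (hbdd : ∃ δ : ℝ, 0 < δ ∧ ∀ x, δ ≤ ω x)
    (X : Submodule ℂ (BeurlingAlgebra μ ω))
    (hX : IsBanachComplement (cosetKernel μ ω H ν lam) X)
    (hcomm : ∀ x ∈ X, ∀ y ∈ X,
      x * y - y * x ∈ commutatorClosure (cosetKernel μ ω H ν lam) ⊔ X)
    (hwa : WeaklyAmenable (BeurlingAlgebra μ ω)) :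
    WeaklyAmenable (BeurlingAlgebra lam (quotientWeight H ω)) := by
  obtain ⟨δ, hδ0, hδ⟩ := hbdd
  have : T2Space (G ⧸ H) := inferInstance
  obtain ⟨k, hk0, hkR, hkC⟩ := exists_integral_cosetPushforward_eq hH μ ν lam
  obtain ⟨T, hT⟩ := exists_cosetMap (μ := μ) (ν := ν) (lam := lam) hH hω hδ0 hδ
  have hw := measurable_quotientWeight (H := H) hω
  have hwpos := quotientWeight_pos (H := H) hδ0 hδ
  refine WeaklyAmenable.of_surjective T (cosetMap_surjective hH hω hδ0 hδ hk0 hkR hT)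
    (k := k) (by exact_mod_cast hk0.ne')
    (toFun_mul_cosetMap hH hω hδ0 hδ hk0 hkR hkC hT) (BeurlingAlgebra.zero_mul hw hwpos)
    (BeurlingAlgebra.mul_zero hw hwpos) (fun f => ?_) X hX hcomm hwa
  change (∀ᵐ q ∂lam, cosetIntegral H ν f.toFun q = 0) ↔ _
  constructor
  · intro h
    refine BeurlingAlgebra.ext_ae ((ae_weightedMeasure_iff hw hwpos).2 ?_)
    filter_upwards [h, hT f, BeurlingAlgebra.toFun_zero_ae (μ := lam) hw hwpos] with q h1 h2 h3
    rw [h2, h1, h3]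
    rfl
  · intro h
    have h4 := hT f
    rw [h] at h4
    filter_upwards [h4, BeurlingAlgebra.toFun_zero_ae (μ := lam) hw hwpos] with q h1 h2
    rw [← h1, h2]
    rfl
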